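/- Let $P$ be a finite set of points in the Euclidean plane and $K\ge 1$ an integer. For a point $u$ and $0\le j<K$ let $C_u^j$ be the cone consisting of the points $v\ne u$ such that the polar angle of the vector from $u$ to $v$ lies in $[2j\pi/K,\,2(j+1)\pi/K)$. A Yao graph $Y_K$ on $P$ is a directed graph obtained by choosing, for each $u\in P$ and each $j$ with $C_u^j\cap P\neq\emptyset$, a point $v\in C_u^j\cap P$ with $|uv|$ minimal and adding the edge $\overrightarrow{uv}$. A Yao-Yao (sparse-Yao) graph $YY_K$ on $P$ is obtained from a Yao graph $Y_K$ by choosing, for each $u\in P$ and each $j$ for which there is a point $v\in C_u^j\cap P$ with $\overrightarrow{vu}\in Y_K$, such a $v$ with $|uv|$ minimal and adding the edge $\overrightarrow{vu}$; edge directions are then forgotten. Ties are broken arbitrarily in both steps. A graph with vertex set $P$ is a geometric $t$-spanner if any $u,v\in P$ are joined by a path in it whose total Euclidean length is at most $t\,|uv|$. Put $\tau_K=\bigl(1-2\sin(\tfrac{\pi}{K}+\tfrac{\pi}{8})\bigr)^{-1}$. Theorem. There are constants $\tau'_k$ depending only on $k$, with $\tau'_k=\sqrt2+O(1/k)$ as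 $k\to\infty$, such that, with $t_k=\tau'_k\,\tau_{2k}$, for every integer $k\ge 42$ and every finite set $P$ of points in the plane, every Yao-Yao graph $YY_{2k}$ on $P$ is a geometric $t_k$-spanner. Moreover $$t_k=\sqrt2\,\bigl(1-2\sin(\pi/8)\bigr)^{-1}+O(1/k)\quad(k\to\infty),$$ where $\sqrt2\,(1-2\sin(\pi/8))^{-1}\approx 6.03$, i.e. it differs from $6.03$ by less than $0.005$. -/

import Mathlib

open scoped Real
open Filter Asymptotics

noncomputable section

namespace YaoYao

/-- The Euclidean plane. -/
abbrev Plane : Type := EuclideanSpace ℝ (Fin 2)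

/-- The cone with apex `u` formed by the (open) rays from `u` whose polar angles lie in
`[γ₁, γ₂)`. The apex itself has no polar angle and is not a member. -/
def cone (u : Plane) (γ₁ γ₂ : ℝ) : Set Plane :=
  {v | ∃ r : ℝ, 0 < r ∧ ∃ φ ∈ Set.Ico γ₁ γ₂,
    v 0 = u 0 + r * Real.cos φ ∧ v 1 = u 1 + r * Real.sin φ}

/-- The points of `P` in the `j`-th of the `K` equal cones with apex `u`. -/
def conePoints (K : ℕ) (P : Finset Plane) (u : P) (j : Fin K) : Set P :=
  {v | (v : Plane) ∈ cone u (2 * (j : ℝ) * π / K) (2 * ((j : ℝ) + 1) * π / K)}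

/-- `s` selects, for every point `u` and every index `j` with at least one candidate, a candidate
at the shortest distance from `u`. Ties are broken arbitrarily; where there is no
candidate, the value of `s` is irrelevant. -/
def IsNearestSelection {K : ℕ} {P : Finset Plane} (cand : P → Fin K → Set P)
    (s : P → Fin K → P) : Prop :=
  ∀ u j, (cand u j).Nonempty →
    s u j ∈ cand u j ∧ ∀ w ∈ cand u j, dist (u : Plane) (s u j) ≤ dist (u : Plane) w

/-- `Y` is (the directed edge relation of) a Yao graph `Y_K` on `P`, for some way of breaking ties:
`Y u v` says that the directed edge from `u` to `v` is present. -/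
def IsYaoGraph (K : ℕ) (P : Finset Plane) (Y : P → P → Prop) : Prop :=
  ∃ s : P → Fin K → P, IsNearestSelection (conePoints K P) s ∧
    ∀ u v, Y u v ↔ ∃ j, (conePoints K P u j).Nonempty ∧ v = s u j

/-- Candidates of the reverse Yao step at `u`: points `v` in the `j`-th cone at `u` such that
the directed edge from `v` to `u` is in `Y`. -/
def reverseCandidates (K : ℕ) (P : Finset Plane) (Y : P → P → Prop) (u : P) (j : Fin K) : Set P :=
  {v | v ∈ conePoints K P u j ∧ Y v u}

/-- `D` is (the directed edge relation of) the result of a reverse Yao step applied to `Y`. -/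
def IsReverseYaoStep (K : ℕ) (P : Finset Plane) (Y D : P → P → Prop) : Prop :=
  ∃ s : P → Fin K → P, IsNearestSelection (reverseCandidates K P Y) s ∧
    ∀ v u, D v u ↔ ∃ j, (reverseCandidates K P Y u j).Nonempty ∧ v = s u j

/-- `G` is a Yao-Yao graph `YY_K` on `P` (edge directions forgotten), for some way of breaking
ties in the two steps of its construction. -/
def IsYaoYaoGraph (K : ℕ) (P : Finset Plane) (G : SimpleGraph P) : Prop :=
  ∃ Y D : P → P → Prop, IsYaoGraph K P Y ∧ IsReverseYaoStep K P Y D ∧ G = SimpleGraph.fromRel D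

/-- Total Euclidean length of a walk. -/
def walkLength {P : Finset Plane} {G : SimpleGraph P} {u v : P} (p : G.Walk u v) : ℝ :=
  (p.darts.map fun d => dist (d.fst : Plane) (d.snd : Plane)).sum

/-- `G` is a geometric `t`-spanner of `P`. -/
def IsGeometricSpanner {P : Finset Plane} (G : SimpleGraph P) (t : ℝ) : Prop :=
  ∀ u v : P, ∃ p : G.Walk u v, p.IsPath ∧ walkLength p ≤ t * dist (u : Plane) (v : Plane)

/-- The constant `τ_K = (1 - 2 sin(π/K + π/8))⁻¹`. -/
def tau (K : ℕ) : ℝ := (1 - 2 * Real.sin (π / K + π / 8))⁻¹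

end YaoYao

end

noncomputable section

namespace YaoYao

/-! Put θ = π/k and induct on |uv|. At u, take a sector of aperture about π/2, made of whole cones,
around the direction of v, and a nearest point of P in it. With an even number of cones the opposite
of a cone is a cone, so `IsYaoYaoGraph.exists_edge` yields in that point's cone some x, no farther
from u, and an edge wx that is nearly parallel to ux and no longer. If u reaches x at cost B|ux|,
induction handles x to v: the angle between ux and uv is at most π/4 + O(θ), so the distance to v
drops by at least |ux|(1 - 2 sin(π/8 + O(θ))), and B/t is chosen below that factor.

The difficulty is to get from u to w, which is nearly level with u or lower but need not be close.
With the horizontal axis along the boundary ray of the sector on the side of x, no point of the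
quadrant below u is nearer than x. Hence w is not below u once it lies ahead, and
`reach_of_empty_corridor` applies. It travels back from w to u by hops, paying 33/20 * t per unit of
height, enough for steep stretches to be bought by the main induction, but only B per unit of width.
A hop from z to x whose edge has tail v leaves the same problem for (z, v): smaller distance,
reversed direction. Emptiness of the region below u keeps the hops from falling below u and passes
to the new problem.

The price 33/20 must dominate √2 + B/t and 1 / cos(π/4 + θ). With B/t close to 1 - 2 sin(π/8) ≈
0.2346, what remains is 1 ≤ t (0.2346 - O(1/k)). For large k this holds with room to spare at t ≈
6.03. -/

/-! ### Reachability by short walks -/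

/-- `u` and `v` are joined by a walk of length at most `c`. -/
def Reach {P : Finset Plane} (G : SimpleGraph P) (u v : P) (c : ℝ) : Prop :=
  ∃ p : G.Walk u v, walkLength p ≤ c

section Reach

variable {P : Finset Plane} {G : SimpleGraph P}

lemma walkLength_append {u v w : P} (p : G.Walk u v) (q : G.Walk v w) :
    walkLength (p.append q) = walkLength p + walkLength q := by
  simp [walkLength]

lemma walkLength_nonneg {u v : P} (p : G.Walk u v) : 0 ≤ walkLength p := by
  apply List.sum_nonneg
  intro x hx
  obtain ⟨d, -, rfl⟩ := List.mem_map.1 hx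
  exact dist_nonneg

lemma walkLength_reverse {u v : P} (p : G.Walk u v) :
    walkLength p.reverse = walkLength p := by
  simp only [walkLength, SimpleGraph.Walk.darts_reverse, List.map_reverse, List.sum_reverse,
    List.map_map]
  congr 1
  apply List.map_congr_left
  intro d _
  simp [dist_comm]

lemma walkLength_cons {u v w : P} (h : G.Adj u v) (p : G.Walk v w) :
    walkLength (SimpleGraph.Walk.cons h p) = dist (u : Plane) v + walkLength p := by
  simp [walkLength]

lemma walkLength_bypass_le [DecidableEq P] {u v : P} (p : G.Walk u v) :
    walkLength p.bypass ≤ walkLength p := by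
  induction p with
  | nil => simp [SimpleGraph.Walk.bypass]
  | @cons u v w h p ih =>
    rw [SimpleGraph.Walk.bypass, walkLength_cons]
    have hd : 0 ≤ dist (u : Plane) v := dist_nonneg
    split_ifs with hs
    · have h1 := walkLength_append (p.bypass.takeUntil u hs) (p.bypass.dropUntil u hs)
      rw [SimpleGraph.Walk.take_spec] at h1
      have h2 := walkLength_nonneg (p.bypass.takeUntil u hs)
      linarith
    · rw [walkLength_cons]
      linarith

/-- Walks concatenate freely, so all estimates use them; deleting loops at the very end never adds
length. -/
lemma Reach.exists_isPath {u v : P} {c : ℝ} (h : Reach G u v c) :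
    ∃ p : G.Walk u v, p.IsPath ∧ walkLength p ≤ c := by
  classical
  obtain ⟨p, hp⟩ := h
  exact ⟨p.bypass, p.bypass_isPath, (walkLength_bypass_le p).trans hp⟩

lemma Reach.refl (u : P) : Reach G u u 0 := ⟨SimpleGraph.Walk.nil, by simp [walkLength]⟩

lemma Reach.symm {u v : P} {c : ℝ} (h : Reach G u v c) : Reach G v u c := by
  obtain ⟨p, hp⟩ := h
  exact ⟨p.reverse, by rwa [walkLength_reverse]⟩

lemma Reach.trans {u v w : P} {c d : ℝ} (h : Reach G u v c) (h' : Reach G v w d) :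
    Reach G u w (c + d) := by
  obtain ⟨p, hp⟩ := h
  obtain ⟨q, hq⟩ := h'
  exact ⟨p.append q, by rw [walkLength_append]; exact add_le_add hp hq⟩

lemma Reach.mono {u v : P} {c d : ℝ} (h : Reach G u v c) (hcd : c ≤ d) : Reach G u v d := by
  obtain ⟨p, hp⟩ := h
  exact ⟨p, hp.trans hcd⟩

lemma Reach.of_adj {u v : P} (h : G.Adj u v) : Reach G u v (dist (u : Plane) v) :=
  ⟨SimpleGraph.Walk.cons h SimpleGraph.Walk.nil, by simp [walkLength]⟩

end Reach

/-! ### Trigonometric estimates -/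

lemma cos_le_cos_add_abs_sub (x y : ℝ) : Real.cos x ≤ Real.cos y + |x - y| := by
  have h : |Real.cos x - Real.cos y| ≤ |x - y| := by
    have := Real.lipschitzWith_cos.dist_le_mul x y
    simpa [Real.dist_eq] using this
  have := le_abs_self (Real.cos x - Real.cos y)
  linarith

lemma sin_le_sin_add_abs_sub (x y : ℝ) : Real.sin x ≤ Real.sin y + |x - y| := by
  have h : |Real.sin x - Real.sin y| ≤ |x - y| := by
    have := Real.lipschitzWith_sin.dist_le_mul x y
    simpa [Real.dist_eq] using this
  have := le_abs_self (Real.sin x - Real.sin y)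
  linarith

lemma one_le_cos_add_sin {x : ℝ} (h0 : 0 ≤ x) (h1 : x ≤ π / 2) :
    1 ≤ Real.cos x + Real.sin x := by
  have hc := Real.cos_nonneg_of_neg_pi_div_two_le_of_le (by linarith) h1
  have hs := Real.sin_nonneg_of_nonneg_of_le_pi h0 (by linarith [Real.pi_pos])
  nlinarith [Real.sin_sq_add_cos_sq x, mul_nonneg hc hs]

/-- Squared length of the third side of the triangle with sides `l`, `r` pointing in the
directions `x`, `y`. -/
lemma polar_sub_sq (l r x y : ℝ) :
    (l * Real.cos x - r * Real.cos y) ^ 2 + (l * Real.sin x - r * Real.sin y) ^ 2 =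
      l ^ 2 + r ^ 2 - 2 * l * r * Real.cos (x - y) := by
  rw [Real.cos_sub]
  linear_combination l ^ 2 * Real.sin_sq_add_cos_sq x + r ^ 2 * Real.sin_sq_add_cos_sq y

lemma polar_sub_sq_lt {l r x y θ : ℝ} (hr : 0 < r) (hrl : r ≤ l) (hxy : |x - y| ≤ θ)
    (hθ : θ ≤ 1 / 13) :
    (l * Real.cos x - r * Real.cos y) ^ 2 + (l * Real.sin x - r * Real.sin y) ^ 2 < l ^ 2 := by
  rw [polar_sub_sq]
  have h := cos_le_cos_add_abs_sub 0 (x - y)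
  rw [Real.cos_zero, zero_sub, abs_neg] at h
  have : 1 / 2 < Real.cos (x - y) := by linarith
  nlinarith [mul_pos (hr.trans_le hrl) hr]

/-- If the backward step `r` retreats at least as far as the forward step `l` advanced, then the
two steps nearly cancel. -/
lemma polar_sub_sq_le_of_retreat {l r x y θ : ℝ} (hr : 0 < r) (hrl : r ≤ l) (hxy : |x - y| ≤ θ)
    (hx : 0 < Real.cos x) (hback : l * Real.cos x ≤ r * Real.cos y) :
    (l * Real.cos x - r * Real.cos y) ^ 2 + (l * Real.sin x - r * Real.sin y) ^ 2 ≤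
      (r * θ / Real.cos x) ^ 2 := by
  rw [div_pow, le_div_iff₀ (by positivity)]
  have hs : Real.sin (x - y) ^ 2 ≤ θ ^ 2 := by
    rw [sq_le_sq]
    have := Real.abs_sin_le_abs (x := x - y)
    exact this.trans (hxy.trans (le_abs_self _))
  have h1 : (r * Real.sin (x - y)) ^ 2 ≤ (r * θ) ^ 2 := by
    rw [mul_pow, mul_pow]
    exact mul_le_mul_of_nonneg_left hs (by positivity)
  refine le_trans ?_ h1
  have hc : Real.cos (x - y) ≤ 1 := Real.cos_le_one _
  have h2 : 0 ≤ r * Real.cos y + l * Real.cos x - 2 * r * Real.cos (x - y) * Real.cos x := by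
    have h3 : r * Real.cos (x - y) * Real.cos x ≤ l * Real.cos x := by
      apply mul_le_mul_of_nonneg_right _ hx.le
      nlinarith
    linarith
  have h4 := mul_nonneg (sub_nonneg.2 hback) h2
  rw [polar_sub_sq]
  have hy : Real.cos y = Real.cos x * Real.cos (x - y) + Real.sin x * Real.sin (x - y) := by
    have := Real.cos_sub x (x - y)
    rwa [sub_sub_cancel] at this
  have e1 := Real.sin_sq_add_cos_sq x
  have e2 := Real.sin_sq_add_cos_sq (x - y)
  rw [hy] at h4
  -- The defect factors into the excess of the retreat over the advance and a term that is
  -- nonnegative because r cos(x - y) ≤ r ≤ l.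
  have key : (r * Real.sin (x - y)) ^ 2 -
      (l ^ 2 + r ^ 2 - 2 * l * r * Real.cos (x - y)) * Real.cos x ^ 2 =
      (r * (Real.cos x * Real.cos (x - y) + Real.sin x * Real.sin (x - y)) - l * Real.cos x) *
      (r * (Real.cos x * Real.cos (x - y) + Real.sin x * Real.sin (x - y)) + l * Real.cos x -
        2 * r * Real.cos (x - y) * Real.cos x) := by
    linear_combination -(r ^ 2 * Real.sin (x - y) ^ 2) * e1 + Real.cos x ^ 2 * r ^ 2 * e2
  linarith

/-! ### Hops -/

/-- The sign of the horizontal direction: right for `true`, left for `false`. -/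
def sgn (b : Bool) : ℝ := if b then 1 else -1

/-- `y'` lies below `y`: strictly for `true`, weakly for `false`. -/
def Below (b : Bool) (y y' : ℝ) : Prop := if b then y' < y else y' ≤ y

lemma sgn_mul_self (b : Bool) : sgn b * sgn b = 1 := by cases b <;> simp [sgn]

lemma sgn_not (b : Bool) : sgn (!b) = -sgn b := by cases b <;> simp [sgn]

lemma Below.le {b : Bool} {y y' : ℝ} (h : Below b y y') : y' ≤ y := by
  cases b
  · simpa [Below] using h
  · simp only [Below, if_true] at h
    exact h.le

/-- Reversing the direction exchanges strict and weak, in step with the half-open cones. This lets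
the corridor argument recurse with `!b` without losing boundary cases. -/
lemma not_below_iff {b : Bool} {y y' : ℝ} : ¬ Below b y y' ↔ Below (!b) y' y := by
  cases b <;> simp [Below]

lemma not_below_not_iff {b : Bool} {y y' : ℝ} : ¬ Below (!b) y y' ↔ Below b y' y := by
  cases b <;> simp [Below]

lemma Below.trans_le {b : Bool} {y y' y'' : ℝ} (h : Below b y y') (h' : y'' ≤ y') :
    Below b y y'' := by
  cases b
  · simp only [Below] at h ⊢
    exact h'.trans h
  · simp only [Below, if_true] at h ⊢
    exact h'.trans_lt h

/-- In the coordinates `X`, `Y`, looking horizontally in direction `b`, the point `x` is reached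
from `z` by a step of length `l` descending at angle `χ`; and `wx` is an edge of `G` of length
`r ≤ l`, descending from `w` at an angle `χ'` that differs from `χ` by at most `θ`. -/
structure Hop {P : Finset Plane} (G : SimpleGraph P) (X Y : P → ℝ) (θ : ℝ) (b : Bool)
    (z x w : P) (l r χ χ' : ℝ) : Prop where
  r_pos : 0 < r
  r_le : r ≤ l
  nonneg : 0 ≤ χ
  le : χ ≤ π / 4 + θ
  abs_sub_le : |χ - χ'| ≤ θ
  fst : sgn b * (X x - X z) = l * Real.cos χ
  snd : Y z - Y x = l * Real.sin χ
  back_fst : sgn b * (X x - X w) = r * Real.cos χ'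
  back_snd : Y w - Y x = r * Real.sin χ'
  below : Below b (Y z) (Y x)
  back_below : Below b (Y w) (Y x)
  adj : G.Adj w x

section Hop

variable {P : Finset Plane} {G : SimpleGraph P} {X Y : P → ℝ} {θ : ℝ} {b : Bool}
  {z x w : P} {l r χ χ' : ℝ}

lemma Hop.advance (h : Hop G X Y θ b z x w l r χ χ') :
    sgn b * (X w - X z) = l * Real.cos χ - r * Real.cos χ' := by
  linear_combination h.fst - h.back_fst

lemma Hop.rise (h : Hop G X Y θ b z x w l r χ χ') :
    Y w - Y z = r * Real.sin χ' - l * Real.sin χ := by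
  linear_combination h.back_snd - h.snd

lemma dist_sq_sgn (hd : ∀ p q : P, dist (p : Plane) q ^ 2 = (X p - X q) ^ 2 + (Y p - Y q) ^ 2)
    (b : Bool) (p q : P) :
    dist (p : Plane) q ^ 2 = (sgn b * (X q - X p)) ^ 2 + (Y p - Y q) ^ 2 := by
  rw [hd, mul_pow, sq (sgn b), sgn_mul_self]
  ring

lemma Hop.dist_sq (h : Hop G X Y θ b z x w l r χ χ')
    (hd : ∀ p q : P, dist (p : Plane) q ^ 2 = (X p - X q) ^ 2 + (Y p - Y q) ^ 2) :
    dist (z : Plane) w ^ 2 =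
      (l * Real.cos χ - r * Real.cos χ') ^ 2 + (l * Real.sin χ - r * Real.sin χ') ^ 2 := by
  rw [dist_sq_sgn hd b, h.advance, ← neg_sub (Y w), h.rise]
  ring

lemma Hop.l_pos (h : Hop G X Y θ b z x w l r χ χ') : 0 < l := h.r_pos.trans_le h.r_le

lemma Hop.dist_lt (h : Hop G X Y θ b z x w l r χ χ')
    (hd : ∀ p q : P, dist (p : Plane) q ^ 2 = (X p - X q) ^ 2 + (Y p - Y q) ^ 2)
    (hθ : θ ≤ 1 / 13) : dist (z : Plane) w < l := by
  refine lt_of_pow_lt_pow_left₀ 2 h.l_pos.le ?_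
  rw [h.dist_sq hd]
  exact polar_sub_sq_lt h.r_pos h.r_le h.abs_sub_le hθ

lemma Hop.dist_eq (h : Hop G X Y θ b z x w l r χ χ')
    (hd : ∀ p q : P, dist (p : Plane) q ^ 2 = (X p - X q) ^ 2 + (Y p - Y q) ^ 2) :
    dist (z : Plane) x = l := by
  refine (pow_left_inj₀ dist_nonneg h.l_pos.le two_ne_zero).1 ?_
  rw [dist_sq_sgn hd b, h.fst, h.snd]
  linear_combination l ^ 2 * Real.sin_sq_add_cos_sq χ

lemma Hop.back_dist_eq (h : Hop G X Y θ b z x w l r χ χ')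
    (hd : ∀ p q : P, dist (p : Plane) q ^ 2 = (X p - X q) ^ 2 + (Y p - Y q) ^ 2) :
    dist (w : Plane) x = r := by
  refine (pow_left_inj₀ dist_nonneg h.r_pos.le two_ne_zero).1 ?_
  rw [dist_sq_sgn hd b, h.back_fst, h.back_snd]
  linear_combination r ^ 2 * Real.sin_sq_add_cos_sq χ'

/-- The cosine is at least 0.7 - 1/13. The reciprocal of 20/33 is the price factor of height. -/
lemma Hop.cos_ge (h : Hop G X Y θ b z x w l r χ χ') (hθ : θ ≤ 1 / 13) :
    20 / 33 ≤ Real.cos χ := by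
  have h1 : Real.cos (π / 4 + θ) ≤ Real.cos χ := by
    refine Real.cos_le_cos_of_nonneg_of_le_pi h.nonneg ?_ h.le
    linarith [Real.pi_gt_three]
  have h2 := cos_le_cos_add_abs_sub (π / 4) (π / 4 + θ)
  have h3 : 0 ≤ θ := (abs_nonneg _).trans h.abs_sub_le
  rw [Real.cos_pi_div_four, sub_add_cancel_left, abs_neg, abs_of_nonneg h3] at h2
  have h4 : (1.4 : ℝ) ≤ √2 := Real.le_sqrt_of_sq_le (by norm_num)
  linarith

/-- A hop can be replaced by a short walk as soon as its starting point `z` can be joined to the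
tail `w` of the edge, in case `w` is ahead of `z`. -/
lemma Hop.reach (h : Hop G X Y θ b z x w l r χ χ')
    (hd : ∀ p q : P, dist (p : Plane) q ^ 2 = (X p - X q) ^ 2 + (Y p - Y q) ^ 2)
    (hθ : θ ≤ 1 / 13) {t B ρ : ℝ} (ht : 0 < t) (hB : 0 ≤ B)
    (htB : 1 + 33 / 20 * t * θ ≤ B * (1 - θ)) (hl : l ≤ ρ)
    (ih : ∀ p q : P, dist (p : Plane) q < ρ → Reach G p q (t * dist (p : Plane) q))
    (ahead : 0 < sgn b * (X w - X z) →
      Reach G z w (33 / 20 * t * (Y w - Y z) + B * (sgn b * (X w - X z)))) :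
    Reach G z x (B * (r + (l - r) * Real.cos χ)) := by
  have hr := h.r_pos
  have hθ0 : 0 ≤ θ := (abs_nonneg _).trans h.abs_sub_le
  have hcos := h.cos_ge hθ
  have hlr : 0 ≤ l - r := sub_nonneg.2 h.r_le
  have hBθ : 0 ≤ B * θ := mul_nonneg hB hθ0
  have edge := Reach.of_adj h.adj
  rw [h.back_dist_eq hd] at edge
  rcases le_or_gt (sgn b * (X w - X z)) 0 with hA | hA
  · rw [h.advance, sub_nonpos] at hA
    have hsmall : dist (z : Plane) w ≤ 33 / 20 * (r * θ) := by
      have h1 : dist (z : Plane) w ≤ r * θ / Real.cos χ := by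
        refine le_of_sq_le_sq ?_ (by positivity)
        rw [h.dist_sq hd]
        exact polar_sub_sq_le_of_retreat hr h.r_le h.abs_sub_le (by linarith) hA
      refine h1.trans ?_
      rw [div_le_iff₀ (by linarith)]
      nlinarith [mul_nonneg hr.le hθ0]
    refine ((ih z w ((h.dist_lt hd hθ).trans_le hl)).trans edge).mono ?_
    have h2 : t * dist (z : Plane) w ≤ t * (33 / 20 * (r * θ)) :=
      mul_le_mul_of_nonneg_left hsmall ht.le
    have h3 : r * (1 + 33 / 20 * t * θ) ≤ r * B :=
      mul_le_mul_of_nonneg_left (by linarith) hr.le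
    have h4 : 0 ≤ B * ((l - r) * Real.cos χ) := by positivity
    linarith
  · refine ((ahead hA).trans edge).mono ?_
    rw [h.advance, h.rise]
    have hsin := sin_le_sin_add_abs_sub χ' χ
    rw [abs_sub_comm] at hsin
    have hcos' := cos_le_cos_add_abs_sub χ χ'
    have h0 : 0 ≤ Real.sin χ := by
      refine Real.sin_nonneg_of_nonneg_of_le_pi h.nonneg ?_
      linarith [h.le, Real.pi_gt_three]
    have hab := h.abs_sub_le
    -- The two steps are parallel up to θ and r ≤ l, so only errors rθ are left in rise and advance.
    -- `htB` pays for them together with the edge.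
    have h1 : r * Real.sin χ' - l * Real.sin χ ≤ r * θ := by nlinarith
    have h2 : l * Real.cos χ - r * Real.cos χ' ≤ (l - r) * Real.cos χ + r * θ := by nlinarith
    have h3 := mul_le_mul_of_nonneg_left h1 (show 0 ≤ 33 / 20 * t by positivity)
    have h4 := mul_le_mul_of_nonneg_left h2 hB
    have h5 := mul_le_mul_of_nonneg_left htB hr.le
    linarith

end Hop

/-! ### The corridor lemma -/

lemma wellFounded_lt_comp {α : Type*} [Finite α] (f : α → ℝ) :
    WellFounded fun a b => f a < f b := by
  have : IsTrans α fun a b => f a < f b := ⟨fun _ _ _ => lt_trans⟩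
  have : Std.Irrefl fun a b : α => f a < f b := ⟨fun a => lt_irrefl (f a)⟩
  exact Finite.wellFounded_of_trans_of_irrefl _

/-- A point `(-a, -β)`, seen from `(p, h)`, that is as near as the origin and at least `h` lower
lies in the disc about `(p, 0)` through the origin. -/
lemma mem_disc_of_near {p h a β : ℝ} (hp : 0 < p) (hh : 0 ≤ h) (hβ : h ≤ β)
    (hn : a ^ 2 + β ^ 2 ≤ p ^ 2 + h ^ 2) :
    a ≤ p ∧ (p - a) ^ 2 + (β - h) ^ 2 ≤ 2 * p * (p - a) := by
  have h1 : (p - a) ^ 2 + (β - h) ^ 2 ≤ 2 * p * (p - a) := by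
    nlinarith [mul_nonneg hh (sub_nonneg.2 hβ)]
  refine ⟨?_, h1⟩
  by_contra hlt
  push Not at hlt
  nlinarith [sq_nonneg (p - a), sq_nonneg (β - h), mul_pos hp (sub_pos.2 hlt)]

/-- The directions lie in [0, π/4] and [0, π/3], so the angle between the vectors is at most π/3 and
its cosine at least 1/2. The conclusion says that the point (a, β) away from (p, h) is no farther
from the origin than (p, h) is. -/
lemma dot_ge_of_flat {p h a β : ℝ} (hh : 0 ≤ h) (hp : h ≤ p) (ha : 0 ≤ a) (hβ : 0 ≤ β)
    (hflat : β ^ 2 ≤ 3 * a ^ 2) (hn : a ^ 2 + β ^ 2 ≤ p ^ 2 + h ^ 2) :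
    a ^ 2 + β ^ 2 ≤ 2 * (p * a + h * β) := by
  have hp0 : 0 ≤ p := hh.trans hp
  have hkey : (a ^ 2 + β ^ 2) * (p ^ 2 + h ^ 2) ≤ (2 * (p * a + h * β)) ^ 2 := by
    have e1 : 0 ≤ p * h * (a * β) := by positivity
    rcases le_total a β with hab | hab
    · have e2 : a ^ 2 ≤ β ^ 2 := pow_le_pow_left₀ ha hab 2
      nlinarith [mul_nonneg (sq_nonneg p) (sub_nonneg.2 hflat),
        mul_nonneg (sq_nonneg h) (sub_nonneg.2 e2), mul_nonneg (sq_nonneg h) (sq_nonneg β)]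
    · have e2 : β ^ 2 ≤ a ^ 2 := pow_le_pow_left₀ hβ hab 2
      have e3 : h ^ 2 ≤ p ^ 2 := pow_le_pow_left₀ hh hp 2
      nlinarith [mul_nonneg (sub_nonneg.2 e2) (sub_nonneg.2 e3), mul_nonneg (sq_nonneg p)
        (sub_nonneg.2 e2), mul_nonneg (sq_nonneg a) (sub_nonneg.2 e3),
        mul_nonneg (sq_nonneg h) (sq_nonneg β)]
  refine le_of_sq_le_sq ?_ (by positivity)
  refine le_trans ?_ hkey
  rw [sq (a ^ 2 + β ^ 2)]
  exact mul_le_mul_of_nonneg_left hn (by positivity)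

/-- The tangent disc replaces the angle bound. When A > p, the excess a(A - p) is at most A² - p² ≤
h² ≤ hβ. -/
lemma dot_ge_of_mem_disc {p h a β A g : ℝ} (hh : 0 ≤ h) (ha : 0 ≤ a)
    (hap : a ≤ p) (hβ : h ≤ β) (hA : 0 ≤ A) (hAg : A ^ 2 + g ^ 2 ≤ p ^ 2 + h ^ 2)
    (hn : a ^ 2 + β ^ 2 ≤ 2 * A * a) : a ^ 2 + β ^ 2 ≤ 2 * (p * a + h * β) := by
  have hhβ : h * h ≤ h * β := mul_le_mul_of_nonneg_left hβ hh
  rcases le_total A p with hAp | hAp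
  · nlinarith [mul_le_mul_of_nonneg_right hAp ha]
  · have h1 : a * (A - p) ≤ (A + p) * (A - p) :=
      mul_le_mul_of_nonneg_right (by linarith) (sub_nonneg.2 hAp)
    nlinarith [sq_nonneg g]

lemma le_sqrt_two_mul_of_sq {d y : ℝ} (hy : 0 ≤ y) (h : d ^ 2 ≤ 2 * y ^ 2) : d ≤ √2 * y := by
  refine le_of_sq_le_sq ?_ (by positivity)
  rwa [mul_pow, Real.sq_sqrt (by norm_num)]

section Corridor

variable {P : Finset Plane} {G : SimpleGraph P} {X Y : P → ℝ} {θ t B ρ : ℝ}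

set_option maxHeartbeats 1000000 in
/-- Suppose that `w` lies ahead of `u` and not below it, and that below `u` there is no point in
the intersection of the disc about `u` through `w` with the disc that is tangent to the vertical
through `u` and centred on the vertical through `w`. Then `u` and `w` are joined by a short walk, where
height is charged at the price `33 / 20 * t` and width at the price `B`. -/
theorem reach_of_empty_corridor
    (hd : ∀ p q : P, dist (p : Plane) q ^ 2 = (X p - X q) ^ 2 + (Y p - Y q) ^ 2)
    (hθ : θ ≤ 1 / 13) (ht : 0 < t) (hB : 0 ≤ B) (hBt : √2 * t + B ≤ 33 / 20 * t)
    (htB : 1 + 33 / 20 * t * θ ≤ B * (1 - θ))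
    (ih : ∀ p q : P, dist (p : Plane) q < ρ → Reach G p q (t * dist (p : Plane) q))
    (hop : ∀ (b : Bool) (z q : P), 0 < sgn b * (X q - X z) → Below b (Y z) (Y q) →
      Y z - Y q ≤ sgn b * (X q - X z) →
      ∃ x w l r χ χ', l ≤ dist (z : Plane) q ∧ Hop G X Y θ b z x w l r χ χ')
    (b : Bool) (u w : P) (huw : dist (u : Plane) w < ρ) (hw : 0 < sgn b * (X w - X u))
    (hnb : ¬ Below b (Y u) (Y w))
    (hempty : ∀ p : P, p ≠ u → Below b (Y u) (Y p) → dist (u : Plane) p ≤ dist (u : Plane) w →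
      dist (u : Plane) p ^ 2 ≤ 2 * (sgn b * (X w - X u)) * (sgn b * (X p - X u)) → False) :
    Reach G u w (33 / 20 * t * (Y w - Y u) + B * (sgn b * (X w - X u))) := by
  -- The direction is quantified inside the induction because each recursive call reverses it.
  suffices H : ∀ a : P × P, ∀ b : Bool, dist (a.1 : Plane) a.2 < ρ →
      0 < sgn b * (X a.2 - X a.1) → ¬ Below b (Y a.1) (Y a.2) →
      (∀ p : P, p ≠ a.1 → Below b (Y a.1) (Y p) →
        dist (a.1 : Plane) p ≤ dist (a.1 : Plane) a.2 → dist (a.1 : Plane) p ^ 2 ≤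
          2 * (sgn b * (X a.2 - X a.1)) * (sgn b * (X p - X a.1)) → False) →
      Reach G a.1 a.2 (33 / 20 * t * (Y a.2 - Y a.1) + B * (sgn b * (X a.2 - X a.1))) from
    H (u, w) b huw hw hnb hempty
  clear hempty hnb hw huw u w b
  intro a
  refine (wellFounded_lt_comp fun a : P × P => dist (a.1 : Plane) a.2).induction
    (C := fun a => ∀ b : Bool, dist (a.1 : Plane) a.2 < ρ →
      0 < sgn b * (X a.2 - X a.1) → ¬ Below b (Y a.1) (Y a.2) →
      (∀ p : P, p ≠ a.1 → Below b (Y a.1) (Y p) →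
        dist (a.1 : Plane) p ≤ dist (a.1 : Plane) a.2 → dist (a.1 : Plane) p ^ 2 ≤
          2 * (sgn b * (X a.2 - X a.1)) * (sgn b * (X p - X a.1)) → False) →
      Reach G a.1 a.2 (33 / 20 * t * (Y a.2 - Y a.1) + B * (sgn b * (X a.2 - X a.1)))) a ?_
  clear a
  rintro ⟨u, w⟩ outer b huw hw hnb hempty
  simp only at outer huw hw hnb hempty ⊢
  -- coordinates relative to `u`, pointing towards `w`
  obtain ⟨ξ, hξ⟩ : ∃ ξ : P → ℝ, ∀ p, ξ p = sgn b * (X p - X u) := ⟨_, fun _ => rfl⟩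
  obtain ⟨η, hη⟩ : ∃ η : P → ℝ, ∀ p, η p = Y p - Y u := ⟨_, fun _ => rfl⟩
  have hdξ : ∀ p q : P, dist (p : Plane) q ^ 2 = (ξ p - ξ q) ^ 2 + (η p - η q) ^ 2 := by
    intro p q
    rw [dist_sq_sgn hd b, hξ, hξ, hη, hη]
    ring
  have hξu : ξ u = 0 := by rw [hξ]; ring
  have hηu : η u = 0 := by rw [hη]; ring
  have hdu : ∀ p : P, dist (u : Plane) p ^ 2 = ξ p ^ 2 + η p ^ 2 := by
    intro p
    rw [hdξ, hξu, hηu]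
    ring
  have hnot : ∀ p z : P, sgn (!b) * (X p - X z) = ξ z - ξ p := by
    intro p z
    rw [sgn_not, hξ, hξ]
    ring
  simp only [← hξ, ← hη] at hw hempty ⊢
  have hhw : 0 ≤ η w := by
    rw [hη]
    linarith [(not_below_iff.1 hnb).le]
  have empty' : ∀ p : P, p ≠ u → Below b (Y u) (Y p) → ξ p ^ 2 + η p ^ 2 ≤ ξ w ^ 2 + η w ^ 2 →
      ξ p ^ 2 + η p ^ 2 ≤ 2 * ξ w * ξ p → False := by
    intro p h1 h2 h3 h4
    refine hempty p h1 h2 ?_ (by rwa [hdu])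
    refine le_of_sq_le_sq ?_ dist_nonneg
    rwa [hdu, hdu]
  -- An inner induction on the horizontal distance from u, within the box spanned by u and w.
  suffices walk : ∀ z : P, 0 < ξ z → ξ z ≤ ξ w → Below (!b) (Y z) (Y u) → η z ≤ η w →
      Reach G u z (33 / 20 * t * η z + B * ξ z) from
    walk w hw le_rfl (not_below_iff.1 hnb) le_rfl
  intro z
  refine (wellFounded_lt_comp ξ).induction (C := fun z => 0 < ξ z → ξ z ≤ ξ w →
    Below (!b) (Y z) (Y u) → η z ≤ η w → Reach G u z (33 / 20 * t * η z + B * ξ z)) z ?_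
  clear z
  intro z inner hz0 hzw hzu hzh
  have hhz : 0 ≤ η z := by
    rw [hη]
    linarith [hzu.le]
  have huz : dist (u : Plane) z ≤ dist (u : Plane) w := by
    refine le_of_sq_le_sq ?_ dist_nonneg
    rw [hdu, hdu]
    exact add_le_add (pow_le_pow_left₀ hz0.le hzw 2) (pow_le_pow_left₀ hhz hzh 2)
  have ht2 : √2 * t ≤ 33 / 20 * t := by linarith
  rcases le_or_gt (ξ z) (η z) with hsteep | hflat
  · refine (ih u z (huz.trans_lt huw)).mono ?_
    have h1 : dist (u : Plane) z ≤ √2 * η z := by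
      refine le_sqrt_two_mul_of_sq hhz ?_
      rw [hdu]
      linarith [pow_le_pow_left₀ hz0.le hsteep 2]
    have h2 := mul_le_mul_of_nonneg_left h1 ht.le
    have h3 := mul_le_mul_of_nonneg_right ht2 hhz
    have h4 := mul_nonneg hB hz0.le
    linarith
  -- the points below `z` on the way back to `u`
  set Q : Set P := {p | ξ p < ξ z ∧ Below (!b) (Y z) (Y p) ∧ (p = u ∨ Below (!b) (Y p) (Y u))}
    with hQ
  have hηQ : ∀ p ∈ Q, 0 ≤ η p ∧ η p ≤ η z := by
    rintro p ⟨-, h2, h3⟩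
    constructor
    · rcases h3 with rfl | h3
      · exact hηu.ge
      · rw [hη]; linarith [h3.le]
    · rw [hη, hη]; linarith [h2.le]
  have huQ : u ∈ Q := ⟨by rw [hξu]; exact hz0, hzu, Or.inl rfl⟩
  obtain ⟨q, hqQ, hq⟩ := Set.exists_min_image Q (fun p : P => dist (z : Plane) p)
    (Set.toFinite Q) ⟨u, huQ⟩
  have hzuρ : dist (z : Plane) u < ρ := by
    rw [dist_comm]
    exact huz.trans_lt huw
  have hzu2 : dist (z : Plane) u ^ 2 = ξ z ^ 2 + η z ^ 2 := by rw [dist_comm, hdu]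
  have continue_from : ∀ x ∈ Q, dist (z : Plane) x ≤ dist (z : Plane) u →
      Reach G u x (33 / 20 * t * η x + B * ξ x) := by
    intro x hx hzx
    obtain ⟨hx0, hxz⟩ := hηQ x hx
    obtain ⟨hx1, hx2, hx3⟩ := hx
    rcases eq_or_ne x u with rfl | hxu
    · rw [hξu, hηu]
      simpa using Reach.refl x
    have hx3' := hx3.resolve_left hxu
    rcases lt_or_ge 0 (ξ x) with hpos | hneg
    · exact inner x hx1 hpos (hx1.le.trans hzw) hx3' (hxz.trans hzh)
    -- The hop overshot u. As x is no farther from z than u, and uz is flat, the overshoot is at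
    -- most η x; the term B * ξ x is then negative or zero, and `hBt` makes up for it.
    · have h1 : (ξ z - ξ x) ^ 2 + (η z - η x) ^ 2 ≤ ξ z ^ 2 + η z ^ 2 := by
        rw [← hdξ, ← hzu2]
        exact pow_le_pow_left₀ dist_nonneg hzx 2
      have h2 : -ξ x ≤ η x := by
        by_contra hlt
        push Not at hlt
        have e1 : η z * η x ≤ ξ z * η x := mul_le_mul_of_nonneg_right hflat.le hx0
        have e2 : ξ z * η x < ξ z * (-ξ x) := mul_lt_mul_of_pos_left hlt hz0
        linarith [sq_nonneg (ξ x), sq_nonneg (η x)]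
      have h3 : dist (u : Plane) x ≤ √2 * η x := by
        refine le_sqrt_two_mul_of_sq hx0 ?_
        rw [hdu]
        linarith [pow_le_pow_left₀ (neg_nonneg.2 hneg) h2 2]
      have h4 : dist (u : Plane) x ≤ dist (u : Plane) z := by
        refine le_of_sq_le_sq ?_ dist_nonneg
        rw [hdu, hdu]
        have e1 := pow_le_pow_left₀ (neg_nonneg.2 hneg) (h2.trans (hxz.trans hflat.le)) 2
        have e2 := pow_le_pow_left₀ hx0 hxz 2
        linarith
      refine (ih u x (h4.trans_lt (huz.trans_lt huw))).mono ?_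
      have h5 := mul_le_mul_of_nonneg_left h3 ht.le
      have h6 := mul_le_mul_of_nonneg_right hBt hx0
      have h7 := mul_le_mul_of_nonneg_left h2 hB
      linarith
  have steep : ∀ x ∈ Q, dist (z : Plane) x ≤ dist (z : Plane) u → ξ z - ξ x ≤ η z - η x →
      Reach G u z (33 / 20 * t * η z + B * ξ z) := by
    intro x hx hzx hsteep
    refine ((continue_from x hx hzx).trans (ih z x (hzx.trans_lt hzuρ)).symm).mono ?_
    have h0 : 0 < ξ z - ξ x := sub_pos.2 hx.1
    have h1 : dist (z : Plane) x ≤ √2 * (η z - η x) := by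
      refine le_sqrt_two_mul_of_sq (h0.le.trans hsteep) ?_
      rw [hdξ]
      linarith [pow_le_pow_left₀ h0.le hsteep 2]
    have h2 := mul_le_mul_of_nonneg_left h1 ht.le
    have h3 := mul_le_mul_of_nonneg_right ht2 (h0.le.trans hsteep)
    have h4 := mul_nonneg hB h0.le
    linarith
  have hzq : dist (z : Plane) q ≤ dist (z : Plane) u := hq u huQ
  rcases le_or_gt (ξ z - ξ q) (η z - η q) with hqs | hqf
  · exact steep q hqQ hzq hqs
  have hηsub : ∀ p q : P, Y p - Y q = η p - η q := by
    intro p q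
    rw [hη, hη]
    ring
  obtain ⟨x, v, l, r, χ, χ', hlq, hhop⟩ := hop (!b) z q (by rw [hnot]; linarith [hqQ.1]) hqQ.2.1
    (by rw [hnot, hηsub]; exact hqf.le)
  have hl0 := hhop.l_pos
  have hcos := hhop.cos_ge hθ
  have hzx : dist (z : Plane) x = l := hhop.dist_eq hd
  have hlu : l ≤ dist (z : Plane) u := hlq.trans hzq
  have hlu2 : l ^ 2 ≤ ξ z ^ 2 + η z ^ 2 := by
    rw [← hzu2]
    exact pow_le_pow_left₀ hl0.le hlu 2
  have hax : ξ z - ξ x = l * Real.cos χ := by rw [← hnot, hhop.fst]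
  have hδx : η z - η x = l * Real.sin χ := by rw [← hηsub, hhop.snd]
  have hsin : 0 ≤ Real.sin χ := by
    refine Real.sin_nonneg_of_nonneg_of_le_pi hhop.nonneg ?_
    linarith [hhop.le, Real.pi_gt_three]
  have hax0 : 0 < ξ z - ξ x := by rw [hax]; positivity
  -- a point below `u` that is nearer to `z` than `u` cannot be close to `u`
  have not_below : ∀ p : P, p ≠ u → Below b (Y u) (Y p) →
      (ξ z - ξ p) ^ 2 + (η z - η p) ^ 2 ≤ ξ z ^ 2 + η z ^ 2 →
      (0 ≤ ξ z - ξ p → ξ z - ξ p ≤ ξ z → η z ≤ η z - η p →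
        (ξ z - ξ p) ^ 2 + (η z - η p) ^ 2 ≤ 2 * (ξ z * (ξ z - ξ p) + η z * (η z - η p))) →
      0 ≤ ξ z - ξ p → False := by
    intro p hpu hp hnear hdot ha
    have hηp : η p ≤ 0 := by
      rw [hη]
      linarith [hp.le]
    obtain ⟨h1, h2⟩ := mem_disc_of_near hz0 hhz (show η z ≤ η z - η p by linarith) hnear
    have h3 := hdot ha h1 (by linarith)
    refine empty' p hpu hp ?_ ?_
    · have h4 : ξ z ^ 2 + η z ^ 2 ≤ ξ w ^ 2 + η w ^ 2 :=
        add_le_add (pow_le_pow_left₀ hz0.le hzw 2) (pow_le_pow_left₀ hhz hzh 2)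
      linarith
    · have h5 : ξ z * ξ p ≤ ξ w * ξ p := mul_le_mul_of_nonneg_right hzw (by linarith)
      linarith
  have hxQ : x ∈ Q := by
    refine ⟨by linarith, hhop.below, ?_⟩
    by_contra hcon
    push Not at hcon
    obtain ⟨hxu, hxb⟩ := hcon
    have hn : (ξ z - ξ x) ^ 2 + (η z - η x) ^ 2 ≤ ξ z ^ 2 + η z ^ 2 := by
      rw [← hdξ, hzx]
      exact hlu2
    refine not_below x hxu (not_below_not_iff.1 hxb) hn (fun ha _ hβ => ?_) hax0.le
    -- A hop descends at less than π/3, so a head below u would lie in the empty region.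
    refine dot_ge_of_flat hhz hflat.le ha (hhz.trans hβ) ?_ hn
    rw [hax, hδx, mul_pow, mul_pow]
    have : Real.sin χ ^ 2 ≤ 3 * Real.cos χ ^ 2 := by
      have := pow_le_pow_left₀ (by norm_num) hcos 2
      linarith [Real.sin_sq_add_cos_sq χ]
    linarith [mul_le_mul_of_nonneg_left this (sq_nonneg l)]
  have hmin : ∀ p ∈ Q, l ≤ dist (z : Plane) p := fun p hp => hlq.trans (hq p hp)
  have hzxu : dist (z : Plane) x ≤ dist (z : Plane) u := hzx.trans_le hlu
  rcases le_or_gt (ξ z - ξ x) (η z - η x) with hxs | -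
  · exact steep x hxQ hzxu hxs
  have hvl : dist (z : Plane) v < l := hhop.dist_lt hd hθ
  have hvzu : dist (z : Plane) v < dist (u : Plane) w := by
    rw [dist_comm] at hlu
    exact hvl.trans_le (hlu.trans huz)
  have hreach := hhop.reach hd hθ ht hB htB (hlu.trans hzuρ.le) ih fun hA => by
    have hA' : 0 < ξ z - ξ v := by rwa [hnot] at hA
    -- The tail lies above x, which is in `Q`; were it also below z it would be a point of `Q`
    -- nearer than `q`.
    have hvb : ¬ Below (!b) (Y z) (Y v) := by
      intro hvb
      refine (hmin v ⟨by linarith, hvb, ?_⟩).not_gt hvl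
      by_contra hcon
      push Not at hcon
      have h1 : Below b (Y u) (Y v) := not_below_not_iff.1 hcon.2
      have h2 : Below b (Y u) (Y x) := h1.trans_le hhop.back_below.le
      rcases hxQ.2.2 with rfl | h3
      · exact hcon.2 hhop.back_below
      · exact not_below_iff.2 h3 h2
    -- The new region is empty: a point of `Q` in it would be nearer to z than `q`, and a point
    -- below u would lie in the old region.
    refine outer (z, v) hvzu (!b) (hvzu.trans huw) hA hvb ?_
    intro p hpz hpb hpv hpdisc
    simp only at hpz hpb hpv hpdisc
    have hpdisc' : (ξ z - ξ p) ^ 2 + (η z - η p) ^ 2 ≤ 2 * (ξ z - ξ v) * (ξ z - ξ p) := by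
      rwa [hnot, hnot, hdξ] at hpdisc
    have hpos : 0 < dist (z : Plane) p ^ 2 := by
      have : (z : Plane) ≠ p := fun h => hpz (Subtype.ext h.symm)
      have := dist_pos.2 this
      positivity
    rw [hdξ] at hpos
    have hap : 0 < ξ z - ξ p := by
      by_contra hle
      push Not at hle
      linarith [mul_nonneg hA'.le (neg_nonneg.2 hle)]
    have hpl : dist (z : Plane) p < l := hpv.trans_lt hvl
    rcases em (p = u ∨ Below (!b) (Y p) (Y u)) with h | h
    · exact (hmin p ⟨by linarith, hpb, h⟩).not_gt hpl
    push Not at h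
    have hn : (ξ z - ξ p) ^ 2 + (η z - η p) ^ 2 ≤ ξ z ^ 2 + η z ^ 2 := by
      rw [← hdξ]
      exact (pow_le_pow_left₀ dist_nonneg hpl.le 2).trans hlu2
    have hv2 : (ξ z - ξ v) ^ 2 + (η z - η v) ^ 2 ≤ ξ z ^ 2 + η z ^ 2 := by
      rw [← hdξ]
      exact (pow_le_pow_left₀ dist_nonneg hvl.le 2).trans hlu2
    exact not_below p h.1 (not_below_not_iff.1 h.2) hn
      (fun ha hap hβ => dot_ge_of_mem_disc hhz ha hap hβ hA'.le hv2 hpdisc') hap.le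
  refine ((continue_from x hxQ hzxu).trans hreach.symm).mono ?_
  have h1 : 33 / 20 * t * η z + B * ξ z - (33 / 20 * t * η x + B * ξ x) =
      33 / 20 * t * (l * Real.sin χ) + B * (l * Real.cos χ) := by
    rw [← hax, ← hδx]
    ring
  -- The hop costs B r(1 - cos χ) more than its width accounts for; this is at most B l sin χ, which
  -- the price of the descent covers.
  have hcs : 1 ≤ Real.cos χ + Real.sin χ :=
    one_le_cos_add_sin hhop.nonneg (by linarith [hhop.le, Real.pi_gt_three])
  have h2 : B * (r * (1 - Real.cos χ)) ≤ B * (l * Real.sin χ) := by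
    refine mul_le_mul_of_nonneg_left ?_ hB
    exact mul_le_mul hhop.r_le (by linarith) (sub_nonneg.2 (Real.cos_le_one χ)) hl0.le
  have h3 : B * (l * Real.sin χ) ≤ 33 / 20 * t * (l * Real.sin χ) := by
    refine mul_le_mul_of_nonneg_right ?_ (by positivity)
    have : 0 ≤ √2 * t := by positivity
    linarith
  linarith

end Corridor

/-! ### Cones and rotated coordinates -/

lemma dist_sq_eq (u v : Plane) : dist u v ^ 2 = (u 0 - v 0) ^ 2 + (u 1 - v 1) ^ 2 := by
  rw [EuclideanSpace.dist_eq, Real.sq_sqrt (by positivity), Fin.sum_univ_two, Real.dist_eq,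
    Real.dist_eq, sq_abs, sq_abs]

lemma dist_eq_of_polar {u v : Plane} {r φ : ℝ} (hr : 0 ≤ r) (h0 : v 0 = u 0 + r * Real.cos φ)
    (h1 : v 1 = u 1 + r * Real.sin φ) : dist u v = r := by
  refine (pow_left_inj₀ dist_nonneg hr two_ne_zero).1 ?_
  rw [dist_sq_eq, h0, h1]
  linear_combination r ^ 2 * Real.sin_sq_add_cos_sq φ

lemma polar_of_mem_cone {u v : Plane} {γ₁ γ₂ : ℝ} (h : v ∈ cone u γ₁ γ₂) :
    0 < dist u v ∧ ∃ φ ∈ Set.Ico γ₁ γ₂, v 0 = u 0 + dist u v * Real.cos φ ∧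
      v 1 = u 1 + dist u v * Real.sin φ := by
  obtain ⟨r, hr, φ, hφ, h0, h1⟩ := h
  rw [dist_eq_of_polar hr.le h0 h1]
  exact ⟨hr, φ, hφ, h0, h1⟩

lemma exists_polar (u v : Plane) :
    ∃ φ, v 0 = u 0 + dist u v * Real.cos φ ∧ v 1 = u 1 + dist u v * Real.sin φ := by
  set z : ℂ := ⟨v 0 - u 0, v 1 - u 1⟩ with hz
  have hn : ‖z‖ = dist u v := by
    refine (pow_left_inj₀ (norm_nonneg _) dist_nonneg two_ne_zero).1 ?_
    rw [dist_sq_eq, ← Complex.normSq_eq_norm_sq, Complex.normSq_apply]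
    ring
  refine ⟨z.arg, ?_, ?_⟩
  · rw [← hn, Complex.norm_mul_cos_arg]
    ring
  · rw [← hn, Complex.norm_mul_sin_arg]
    ring

lemma mem_cone_add_two_pi {u v : Plane} {γ₁ γ₂ : ℝ} (h : v ∈ cone u γ₁ γ₂) (m : ℤ) :
    v ∈ cone u (γ₁ + m * (2 * π)) (γ₂ + m * (2 * π)) := by
  obtain ⟨r, hr, φ, ⟨hφ₁, hφ₂⟩, h0, h1⟩ := h
  refine ⟨r, hr, φ + m * (2 * π), ⟨by linarith, by linarith⟩, ?_, ?_⟩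
  · rw [Real.cos_add_int_mul_two_pi, h0]
  · rw [Real.sin_add_int_mul_two_pi, h1]

lemma mem_cone_opposite {u v : Plane} {γ₁ γ₂ : ℝ} (h : v ∈ cone u γ₁ γ₂) :
    u ∈ cone v (γ₁ + π) (γ₂ + π) := by
  obtain ⟨r, hr, φ, ⟨hφ₁, hφ₂⟩, h0, h1⟩ := h
  refine ⟨r, hr, φ + π, ⟨by linarith, by linarith⟩, ?_, ?_⟩
  · rw [Real.cos_add_pi, h0]
    ring
  · rw [Real.sin_add_pi, h1]
    ring

/-- The `J`-th cone of angle `π / k` at `u`, for an arbitrary integer `J`. -/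
def sector (k : ℕ) (u : Plane) (J : ℤ) : Set Plane :=
  cone u (J * (π / k)) ((J + 1) * (π / k))

lemma mem_sector_add {k : ℕ} (hk : 0 < k) {u v : Plane} {J : ℤ} (h : v ∈ sector k u J) (m : ℤ) :
    v ∈ sector k u (J + m * (2 * k)) := by
  have hk' : (k : ℝ) ≠ 0 := by positivity
  have := mem_cone_add_two_pi h m
  unfold sector
  convert this using 2
  · push_cast
    field_simp
  · push_cast
    field_simp
    ring

lemma mem_sector_opposite {k : ℕ} (hk : 0 < k) {u v : Plane} {J : ℤ} (h : v ∈ sector k u J) :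
    u ∈ sector k v (J + k) := by
  have hk' : (k : ℝ) ≠ 0 := by positivity
  have := mem_cone_opposite h
  unfold sector
  convert this using 2
  · push_cast
    field_simp
  · push_cast
    field_simp
    ring

lemma conePoints_eq_sector {k : ℕ} (hk : 0 < k) (P : Finset Plane) (u v : P) (j : Fin (2 * k)) :
    v ∈ conePoints (2 * k) P u j ↔ (v : Plane) ∈ sector k u ((j : ℕ) : ℤ) := by
  have hk' : (k : ℝ) ≠ 0 := by positivity
  unfold conePoints sector
  rw [Set.mem_ofPred_eq]
  have h1 : 2 * ((j : ℕ) : ℝ) * π / ((2 * k : ℕ) : ℝ) = (((j : ℕ) : ℤ) : ℝ) * (π / k) := by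
    push_cast
    field_simp
  have h2 : 2 * (((j : ℕ) : ℝ) + 1) * π / ((2 * k : ℕ) : ℝ) =
      ((((j : ℕ) : ℤ) : ℝ) + 1) * (π / k) := by
    push_cast
    field_simp
  rw [h1, h2]

lemma exists_conePoints_iff {k : ℕ} (hk : 0 < k) (P : Finset Plane) (J : ℤ) :
    ∃ j : Fin (2 * k), ∀ u v : P, v ∈ conePoints (2 * k) P u j ↔ (v : Plane) ∈ sector k u J := by
  have hk2 : (0 : ℤ) < 2 * k := by positivity
  have h0 := Int.emod_nonneg J hk2.ne'
  have h1 := Int.emod_lt_of_pos J hk2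
  have hJ := Int.emod_add_mul_ediv J (2 * k)
  refine ⟨⟨(J % (2 * k)).toNat, by omega⟩, fun u v => ?_⟩
  rw [conePoints_eq_sector hk]
  simp only [Int.toNat_of_nonneg h0]
  constructor
  · intro h
    have := mem_sector_add hk h (J / (2 * k))
    rwa [mul_comm (J / _), hJ] at this
  · intro h
    have := mem_sector_add hk h (-(J / (2 * k)))
    rwa [show J + -(J / (2 * k)) * (2 * k) = J % (2 * k) by linarith] at this

/-- In a Yao-Yao graph with an even number of cones, if the `J`-th cone at `z` contains a point,
then it contains a point `x`, no farther, that is the head of an edge whose tail `w` has `x` in its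
own `J`-th cone, no farther than `x` is from `z`. -/
lemma IsYaoYaoGraph.exists_edge {k : ℕ} (hk : 0 < k) {P : Finset Plane} {G : SimpleGraph P}
    (hG : IsYaoYaoGraph (2 * k) P G) (J : ℤ) {z q : P} (hq : (q : Plane) ∈ sector k z J) :
    ∃ x w : P, (x : Plane) ∈ sector k z J ∧ dist (z : Plane) x ≤ dist (z : Plane) q ∧
      (x : Plane) ∈ sector k w J ∧ dist (w : Plane) x ≤ dist (z : Plane) x ∧ G.Adj w x := by
  obtain ⟨Y, D, ⟨s, hs, hY⟩, ⟨s', hs', hD⟩, rfl⟩ := hG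
  obtain ⟨j, hj⟩ := exists_conePoints_iff hk P J
  obtain ⟨j', hj'⟩ := exists_conePoints_iff hk P (J + k)
  have hne : (conePoints (2 * k) P z j).Nonempty := ⟨q, (hj z q).2 hq⟩
  obtain ⟨hx, hxmin⟩ := hs z j hne
  have hxs := (hj _ _).1 hx
  -- The Yao edge out of z competes in the reverse step at its head, so the selected tail is no
  -- farther than z.
  have hzr : z ∈ reverseCandidates (2 * k) P Y (s z j) j' :=
    ⟨(hj' _ _).2 (mem_sector_opposite hk hxs), (hY _ _).2 ⟨j, hne, rfl⟩⟩
  obtain ⟨⟨hw, -⟩, hwmin⟩ := hs' (s z j) j' ⟨z, hzr⟩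
  have hxw : ((s z j : P) : Plane) ∈ sector k (s' (s z j) j') J := by
    have h1 := mem_sector_add hk (mem_sector_opposite hk ((hj' _ _).1 hw)) (-1)
    rwa [show J + k + k + -1 * (2 * k) = J by ring] at h1
  refine ⟨s z j, s' (s z j) j', hxs, hxmin q ((hj z q).2 hq), hxw, ?_, ?_⟩
  · rw [dist_comm, dist_comm (z : Plane)]
    exact hwmin z hzr
  · rw [SimpleGraph.fromRel_adj]
    refine ⟨fun h => ?_, Or.inl ((hD _ _).2 ⟨j', ⟨z, hzr⟩, rfl⟩)⟩
    have := (polar_of_mem_cone hxw).1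
    rw [h, dist_self] at this
    exact this.false

/-- First coordinate in the frame rotated by `ω`. -/
def rotX (ω : ℝ) (p : Plane) : ℝ := p 0 * Real.cos ω + p 1 * Real.sin ω

/-- Second coordinate in the frame rotated by `ω`. -/
def rotY (ω : ℝ) (p : Plane) : ℝ := p 1 * Real.cos ω - p 0 * Real.sin ω

lemma dist_sq_rot (ω : ℝ) (p q : Plane) :
    dist p q ^ 2 = (rotX ω p - rotX ω q) ^ 2 + (rotY ω p - rotY ω q) ^ 2 := by
  rw [dist_sq_eq, rotX, rotX, rotY, rotY]
  linear_combination (-((p 0 - q 0) ^ 2 + (p 1 - q 1) ^ 2)) * Real.sin_sq_add_cos_sq ω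

/-- The polar angle of the ray that, in the frame rotated by `ω`, descends at angle `χ` in the
horizontal direction `b`. -/
def descent (b : Bool) (ω χ : ℝ) : ℝ := if b then ω - χ else ω + π + χ

lemma rot_of_polar {b : Bool} {ω χ ρ : ℝ} {u v : Plane}
    (h0 : v 0 = u 0 + ρ * Real.cos (descent b ω χ))
    (h1 : v 1 = u 1 + ρ * Real.sin (descent b ω χ)) :
    sgn b * (rotX ω v - rotX ω u) = ρ * Real.cos χ ∧
      rotY ω u - rotY ω v = ρ * Real.sin χ := by
  have hω := Real.sin_sq_add_cos_sq ω
  cases b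
  · simp only [descent, Bool.false_eq_true, if_false] at h0 h1
    rw [show ω + π + χ = (ω + χ) + π by ring, Real.cos_add_pi, Real.cos_add] at h0
    rw [show ω + π + χ = (ω + χ) + π by ring, Real.sin_add_pi, Real.sin_add] at h1
    simp only [sgn, Bool.false_eq_true, if_false, rotX, rotY, h0, h1]
    constructor
    · linear_combination ρ * Real.cos χ * hω
    · linear_combination ρ * Real.sin χ * hω
  · simp only [descent, if_true] at h0 h1
    rw [Real.cos_sub] at h0
    rw [Real.sin_sub] at h1
    simp only [sgn, if_true, rotX, rotY, h0, h1]
    constructor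
    · linear_combination ρ * Real.cos χ * hω
    · linear_combination ρ * Real.sin χ * hω

lemma polar_of_rot {b : Bool} {ω χ ρ : ℝ} {u v : Plane}
    (h0 : sgn b * (rotX ω v - rotX ω u) = ρ * Real.cos χ)
    (h1 : rotY ω u - rotY ω v = ρ * Real.sin χ) :
    v 0 = u 0 + ρ * Real.cos (descent b ω χ) ∧ v 1 = u 1 + ρ * Real.sin (descent b ω χ) := by
  have hω := Real.sin_sq_add_cos_sq ω
  cases b
  · simp only [sgn, Bool.false_eq_true, if_false, rotX, rotY] at h0 h1
    simp only [descent, Bool.false_eq_true, if_false]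
    rw [show ω + π + χ = (ω + χ) + π by ring, Real.cos_add_pi, Real.cos_add, Real.sin_add_pi,
      Real.sin_add]
    constructor
    · linear_combination (u 0 - v 0) * hω - Real.cos ω * h0 + Real.sin ω * h1
    · linear_combination (u 1 - v 1) * hω - Real.sin ω * h0 - Real.cos ω * h1
  · simp only [sgn, if_true, rotX, rotY] at h0 h1
    simp only [descent, if_true]
    rw [Real.cos_sub, Real.sin_sub]
    constructor
    · linear_combination (u 0 - v 0) * hω + Real.cos ω * h0 + Real.sin ω * h1
    · linear_combination (u 1 - v 1) * hω + Real.sin ω * h0 - Real.cos ω * h1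

/-- A point that lies ahead and below is seen at an angle of descent between `0` and `π / 2`. -/
lemma exists_descent {b : Bool} {ω : ℝ} {u v : Plane} (ha : 0 < sgn b * (rotX ω v - rotX ω u))
    (hb : Below b (rotY ω u) (rotY ω v)) :
    ∃ χ, 0 ≤ χ ∧ χ < π / 2 ∧ (b = true → 0 < χ) ∧ 0 < dist u v ∧
      sgn b * (rotX ω v - rotX ω u) = dist u v * Real.cos χ ∧
      rotY ω u - rotY ω v = dist u v * Real.sin χ := by
  set z : ℂ := ⟨sgn b * (rotX ω v - rotX ω u), rotY ω u - rotY ω v⟩ with hz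
  have hn : ‖z‖ = dist u v := by
    refine (pow_left_inj₀ (norm_nonneg _) dist_nonneg two_ne_zero).1 ?_
    rw [dist_sq_rot ω, ← Complex.normSq_eq_norm_sq, Complex.normSq_apply]
    linear_combination (rotX ω v - rotX ω u) ^ 2 * sgn_mul_self b
  have hz0 : z ≠ 0 := fun h => by
    have := congrArg Complex.re h
    simp only [hz, Complex.zero_re] at this
    exact ha.ne' this
  have hc : sgn b * (rotX ω v - rotX ω u) = dist u v * Real.cos z.arg := by
    rw [← hn, Complex.norm_mul_cos_arg]
  have hs : rotY ω u - rotY ω v = dist u v * Real.sin z.arg := by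
    rw [← hn, Complex.norm_mul_sin_arg]
  have h1 : |z.arg| < π / 2 := Complex.abs_arg_lt_pi_div_two_iff.2 (Or.inl ha)
  have h2 : 0 ≤ z.arg := Complex.arg_nonneg_iff.2 (sub_nonneg.2 hb.le)
  refine ⟨z.arg, h2, (abs_lt.1 h1).2, fun hbt => ?_, hn ▸ norm_pos_iff.2 hz0, hc, hs⟩
  refine lt_of_le_of_ne h2 fun h => ?_
  rw [← h, Real.sin_zero, mul_zero] at hs
  subst hbt
  simp only [Below, if_true] at hb
  linarith

/-! ### Following Yao-Yao edges -/

/-- Index of the cone whose rays descend, in the frame rotated by `J₀ * (π / k)` and in the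
horizontal direction `b`, at angles between `i * (π / k)` and `(i + 1) * (π / k)`. -/
def descentIndex (k : ℕ) (b : Bool) (J₀ i : ℤ) : ℤ := if b then J₀ - 1 - i else J₀ + k + i

lemma descent_of_mem_sector {k : ℕ} (hk : 0 < k) {b : Bool} {J₀ i : ℤ} {u v : Plane}
    (h : v ∈ sector k u (descentIndex k b J₀ i)) :
    0 < dist u v ∧ ∃ χ, i * (π / k) ≤ χ ∧ χ ≤ (i + 1) * (π / k) ∧
      (b = true → i * (π / k) < χ) ∧
      sgn b * (rotX (J₀ * (π / k)) v - rotX (J₀ * (π / k)) u) = dist u v * Real.cos χ ∧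
      rotY (J₀ * (π / k)) u - rotY (J₀ * (π / k)) v = dist u v * Real.sin χ := by
  have hk' : (k : ℝ) ≠ 0 := by positivity
  have hπ : (k : ℝ) * (π / k) = π := by field_simp
  obtain ⟨hpos, φ, ⟨h1, h2⟩, h3⟩ := polar_of_mem_cone h
  refine ⟨hpos, ?_⟩
  cases b
  · simp only [descentIndex, Bool.false_eq_true, if_false] at h1 h2
    push_cast at h1 h2
    refine ⟨φ - J₀ * (π / k) - π, by linarith, by linarith, by simp, ?_⟩
    have hφ : φ = descent false (J₀ * (π / k)) (φ - J₀ * (π / k) - π) := by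
      simp [descent]
    rw [hφ] at h3
    exact rot_of_polar h3.1 h3.2
  · simp only [descentIndex, if_true] at h1 h2
    push_cast at h1 h2
    refine ⟨J₀ * (π / k) - φ, by linarith, by linarith, fun _ => by linarith, ?_⟩
    have hφ : φ = descent true (J₀ * (π / k)) (J₀ * (π / k) - φ) := by
      simp [descent]
    rw [hφ] at h3
    exact rot_of_polar h3.1 h3.2

lemma below_of_descent {b : Bool} {y y' d χ : ℝ} (hd : 0 < d) (h0 : 0 ≤ χ) (hπ : χ < π)
    (hb : b = true → 0 < χ) (h : y - y' = d * Real.sin χ) : Below b y y' := by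
  cases b
  · simp only [Below, Bool.false_eq_true, if_false]
    have := mul_nonneg hd.le (Real.sin_nonneg_of_nonneg_of_le_pi h0 hπ.le)
    linarith
  · simp only [Below, if_true]
    have := mul_pos hd (Real.sin_pos_of_pos_of_lt_pi (hb rfl) hπ)
    linarith

section Step

variable {k : ℕ} {P : Finset Plane} {G : SimpleGraph P}

lemma hop_of_mem_sector (hk : 0 < k) (hθ : π / k ≤ 1 / 13) {b : Bool} {J₀ i : ℤ} (hi : 0 ≤ i)
    (hi' : i * (π / k) ≤ π / 4) {z x w : P}
    (hx : (x : Plane) ∈ sector k z (descentIndex k b J₀ i))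
    (hw : (x : Plane) ∈ sector k w (descentIndex k b J₀ i))
    (hle : dist (w : Plane) x ≤ dist (z : Plane) x) (hadj : G.Adj w x) :
    ∃ χ χ', Hop G (fun p => rotX (J₀ * (π / k)) p) (fun p => rotY (J₀ * (π / k)) p) (π / k) b
      z x w (dist (z : Plane) x) (dist (w : Plane) x) χ χ' := by
  obtain ⟨hz0, χ, h1, h2, h3, h4, h5⟩ := descent_of_mem_sector hk hx
  obtain ⟨hw0, χ', h1', h2', h3', h4', h5'⟩ := descent_of_mem_sector hk hw
  have hθ0 : 0 < π / k := by positivity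
  have hi0 : 0 ≤ i * (π / k) := mul_nonneg (by exact_mod_cast hi) hθ0.le
  have hπ := Real.pi_gt_three
  refine ⟨χ, χ', hw0, hle, hi0.trans h1, by linarith, ?_, h4, h5, h4', h5', ?_, ?_, hadj⟩
  · rw [abs_le]
    constructor <;> linarith
  · exact below_of_descent hz0 (by linarith) (by linarith) (fun h => hi0.trans_lt (h3 h)) h5
  · exact below_of_descent hw0 (by linarith) (by linarith) (fun h => hi0.trans_lt (h3' h)) h5'

lemma IsYaoYaoGraph.exists_hop (hG : IsYaoYaoGraph (2 * k) P G) (hk : 0 < k)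
    (hθ : π / k ≤ 1 / 13) (J₀ : ℤ) (b : Bool) (z q : P)
    (hX : 0 < sgn b * (rotX (J₀ * (π / k)) q - rotX (J₀ * (π / k)) z))
    (hY : Below b (rotY (J₀ * (π / k)) z) (rotY (J₀ * (π / k)) q))
    (hXY : rotY (J₀ * (π / k)) z - rotY (J₀ * (π / k)) q ≤
      sgn b * (rotX (J₀ * (π / k)) q - rotX (J₀ * (π / k)) z)) :
    ∃ x w l r χ χ', l ≤ dist (z : Plane) q ∧
      Hop G (fun p => rotX (J₀ * (π / k)) p) (fun p => rotY (J₀ * (π / k)) p) (π / k) b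
        z x w l r χ χ' := by
  obtain ⟨χ, h0, h1, h2, hd, hc, hs⟩ := exists_descent hX hY
  have hθ0 : 0 < π / k := by positivity
  have hk' : (k : ℝ) ≠ 0 := by positivity
  have hπ : (k : ℝ) * (π / k) = π := by field_simp
  have hχ : χ ≤ π / 4 := by
    by_contra hlt
    push Not at hlt
    rw [hc, hs] at hXY
    have h3 := le_of_mul_le_mul_left hXY hd
    have h4 : Real.cos χ < Real.cos (π / 2 - χ) :=
      Real.cos_lt_cos_of_nonneg_of_le_pi (by linarith) (by linarith) (by linarith)
    rw [Real.cos_pi_div_two_sub] at h4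
    linarith
  obtain ⟨i, hi, hi', hq⟩ : ∃ i : ℤ, 0 ≤ i ∧ i * (π / k) ≤ π / 4 ∧
      (q : Plane) ∈ sector k z (descentIndex k b J₀ i) := by
    obtain ⟨e0, e1⟩ := polar_of_rot hc hs
    cases b
    · refine ⟨⌊χ / (π / k)⌋, Int.floor_nonneg.2 (by positivity), ?_,
        dist (z : Plane) q, hd, _, ⟨?_, ?_⟩, e0, e1⟩
      · exact ((le_div_iff₀ hθ0).1 (Int.floor_le _)).trans hχ
      · have := (le_div_iff₀ hθ0).1 (Int.floor_le (χ / (π / k)))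
        simp only [descentIndex, descent, Bool.false_eq_true, if_false]
        push_cast
        linarith
      · have := (div_lt_iff₀ hθ0).1 (Int.lt_floor_add_one (χ / (π / k)))
        simp only [descentIndex, descent, Bool.false_eq_true, if_false]
        push_cast
        linarith
    -- Here descent runs clockwise, so cones are half-open at the other end: descent angles fill
    -- (iθ, (i+1)θ], whence ceiling minus one in place of the floor.
    · have h3 := (lt_div_iff₀ hθ0).1 (sub_lt_iff_lt_add.2 (Int.ceil_lt_add_one (χ / (π / k))))
      have h4 := (div_le_iff₀ hθ0).1 (Int.le_ceil (χ / (π / k)))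
      have h5 : 0 < ⌈χ / (π / k)⌉ := Int.ceil_pos.2 (div_pos (h2 rfl) hθ0)
      refine ⟨⌈χ / (π / k)⌉ - 1, by omega, ?_, dist (z : Plane) q, hd, _, ⟨?_, ?_⟩, e0, e1⟩
      · push_cast
        linarith
      · simp only [descentIndex, descent, if_true]
        push_cast
        linarith
      · simp only [descentIndex, descent, if_true]
        push_cast
        linarith
  obtain ⟨x, w, hx, hxq, hw, hwx, hadj⟩ := hG.exists_edge hk _ hq
  obtain ⟨χ₁, χ₂, h⟩ := hop_of_mem_sector hk hθ hi hi' hx hw hwx hadj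
  exact ⟨x, w, _, _, χ₁, χ₂, hxq, h⟩

/-- If no point of the quadrant ahead of and below `u` is nearer than `x`, and `x` lies in the
upper half of the quadrant, then an edge into `x` from the same cone yields a short walk. -/
lemma reach_of_nearest (hG : IsYaoYaoGraph (2 * k) P G) (hk : 0 < k) (hθ : π / k ≤ 1 / 13)
    {t B ρ : ℝ} (ht : 0 < t) (hB : 0 ≤ B) (hBt : √2 * t + B ≤ 33 / 20 * t)
    (htB : 1 + 33 / 20 * t * (π / k) ≤ B * (1 - π / k))
    (ih : ∀ p q : P, dist (p : Plane) q < ρ → Reach G p q (t * dist (p : Plane) q))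
    (b : Bool) (J₀ i : ℤ) (hi : 0 ≤ i) (hi' : i * (π / k) ≤ π / 4) {u x w : P}
    (hx : (x : Plane) ∈ sector k u (descentIndex k b J₀ i))
    (hw : (x : Plane) ∈ sector k w (descentIndex k b J₀ i))
    (hle : dist (w : Plane) x ≤ dist (u : Plane) x) (hadj : G.Adj w x)
    (hρ : dist (u : Plane) x ≤ ρ)
    (hquad : ∀ p : P, 0 < sgn b * (rotX (J₀ * (π / k)) p - rotX (J₀ * (π / k)) u) →
      Below b (rotY (J₀ * (π / k)) u) (rotY (J₀ * (π / k)) p) →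
      dist (u : Plane) x ≤ dist (u : Plane) p) :
    Reach G u x (B * dist (u : Plane) x) := by
  obtain ⟨χ, χ', h⟩ := hop_of_mem_sector hk hθ hi hi' hx hw hle hadj
  have hd : ∀ p q : P, dist (p : Plane) q ^ 2 =
      (rotX (J₀ * (π / k)) p - rotX (J₀ * (π / k)) q) ^ 2 +
      (rotY (J₀ * (π / k)) p - rotY (J₀ * (π / k)) q) ^ 2 := fun p q => dist_sq_rot _ _ _
  have hlt := h.dist_lt hd hθ
  refine (h.reach hd hθ ht hB htB hρ ih fun hA => ?_).mono ?_
  · refine reach_of_empty_corridor hd hθ ht hB hBt htB ih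
      (fun b z q => hG.exists_hop hk hθ J₀ b z q) b u w (hlt.trans_le hρ) hA
      (fun hb => (hquad w hA hb).not_gt hlt) ?_
    intro p hpu hp hpw hdisc
    refine (hquad p ?_ hp).not_gt (hpw.trans_lt hlt)
    have hpos : 0 < dist (u : Plane) p := dist_pos.2 fun h => hpu (Subtype.ext h.symm)
    have hpos2 := pow_pos hpos 2
    by_contra hle
    push Not at hle
    have := mul_nonneg hA.le (neg_nonneg.2 hle)
    linarith
  · refine mul_le_mul_of_nonneg_left ?_ hB
    have := mul_le_mul_of_nonneg_left (Real.cos_le_one χ) (sub_nonneg.2 h.r_le)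
    linarith

end Step

/-- The gain towards `v` when moving from `u` to a point `x`, no farther than `v` and seen at an
angle at most `α` from `v`. -/
lemma dist_le_sub_of_angle {u x v : Plane} {φ ψ α : ℝ} (hα : α ≤ π)
    (hx0 : x 0 = u 0 + dist u x * Real.cos φ) (hx1 : x 1 = u 1 + dist u x * Real.sin φ)
    (hv0 : v 0 = u 0 + dist u v * Real.cos ψ) (hv1 : v 1 = u 1 + dist u v * Real.sin ψ)
    (hle : dist u x ≤ dist u v) (hφψ : |φ - ψ| ≤ α) :
    dist x v ≤ dist u v - dist u x * (1 - 2 * Real.sin (α / 2)) := by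
  have hα0 : 0 ≤ α := (abs_nonneg _).trans hφψ
  obtain ⟨l, hl⟩ : ∃ l, dist u x = l := ⟨_, rfl⟩
  obtain ⟨m, hm⟩ : ∃ m, dist u v = m := ⟨_, rfl⟩
  rw [hl] at hx0 hx1
  rw [hm] at hv0 hv1
  rw [hl, hm] at hle ⊢
  have hl0 : 0 ≤ l := hl ▸ dist_nonneg
  obtain ⟨s, hs⟩ : ∃ s, Real.sin (|φ - ψ| / 2) = s := ⟨_, rfl⟩
  have hs0 : 0 ≤ s := by
    rw [← hs]
    exact Real.sin_nonneg_of_nonneg_of_le_pi (by positivity) (by linarith)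
  have hs1 : s ≤ 1 := hs ▸ Real.sin_le_one _
  have hsα : s ≤ Real.sin (α / 2) := by
    rw [← hs]
    refine Real.sin_le_sin_of_le_of_le_pi_div_two ?_ (by linarith) (by linarith)
    have := abs_nonneg (φ - ψ)
    linarith [Real.pi_pos]
  have hcos : Real.cos (φ - ψ) = 1 - 2 * s ^ 2 := by
    have h1 := Real.cos_sq_add_sin_sq (|φ - ψ| / 2)
    have h2 := Real.cos_two_mul (|φ - ψ| / 2)
    rw [mul_div_cancel₀ _ two_ne_zero, Real.cos_abs] at h2
    rw [hs] at h1
    linarith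
  -- The squares differ by 4 l s (m - l)(1 - s).
  have key : dist x v ≤ m - l + 2 * l * s := by
    refine le_of_sq_le_sq ?_ (by nlinarith)
    have h1 : dist x v ^ 2 = l ^ 2 + m ^ 2 - 2 * l * m * Real.cos (φ - ψ) := by
      rw [← polar_sub_sq, dist_sq_eq, hx0, hx1, hv0, hv1]
      ring
    rw [h1, hcos]
    have h2 : 0 ≤ l * s * ((m - l) * (1 - s)) :=
      mul_nonneg (mul_nonneg hl0 hs0) (mul_nonneg (sub_nonneg.2 hle) (sub_nonneg.2 hs1))
    linarith
  have := mul_le_mul_of_nonneg_left hsα hl0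
  linarith

theorem isGeometricSpanner_of_bounds {k : ℕ} (hk : 0 < k) (hθ : π / k ≤ 1 / 13)
    {P : Finset Plane} {G : SimpleGraph P} (hG : IsYaoYaoGraph (2 * k) P G) {t B : ℝ}
    (ht : 0 < t) (hB : 0 < B) (hBt : √2 * t + B ≤ 33 / 20 * t)
    (htB : 1 + 33 / 20 * t * (π / k) ≤ B * (1 - π / k))
    (hgain : B ≤ t * (1 - 2 * Real.sin (π / 8 + 5 / 8 * (π / k)))) :
    IsGeometricSpanner G t := by
  suffices H : ∀ a : P × P, Reach G a.1 a.2 (t * dist (a.1 : Plane) a.2) from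
    fun u v => (H (u, v)).exists_isPath
  intro a
  refine (wellFounded_lt_comp fun a : P × P => dist (a.1 : Plane) a.2).induction
    (C := fun a => Reach G a.1 a.2 (t * dist (a.1 : Plane) a.2)) a ?_
  clear a
  rintro ⟨u, v⟩ hrec
  simp only at hrec ⊢
  have ih : ∀ p q : P, dist (p : Plane) q < dist (u : Plane) v →
      Reach G p q (t * dist (p : Plane) q) := fun p q h => hrec (p, q) h
  rcases eq_or_ne u v with rfl | huv
  · simpa using Reach.refl u
  have huv0 : 0 < dist (u : Plane) v := dist_pos.2 fun h => huv (Subtype.ext h)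
  have hk' : (0 : ℝ) < k := by positivity
  have hπk : (k : ℝ) * (π / k) = π := by field_simp
  obtain ⟨θ, hθdef⟩ : ∃ θ, π / k = θ := ⟨_, rfl⟩
  have hθ0 : 0 < θ := by rw [← hθdef]; positivity
  have hπθ : (k : ℝ) * θ = π := hθdef ▸ hπk
  have hθ' : θ ≤ 1 / 13 := hθdef ▸ hθ
  -- the wide sector around the direction of `v`
  obtain ⟨ψ, hψ0, hψ1⟩ := exists_polar (u : Plane) v
  -- N = ⌈k/2⌉ is the least number of cones spanning a right angle, so the sector contains the
  -- quadrants used below; M = ⌊N/2⌋ of them precede the cone of v.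
  obtain ⟨N, hN, hN'⟩ : ∃ N : ℤ, (k : ℤ) ≤ 2 * N ∧ 2 * N ≤ k + 1 :=
    ⟨((k : ℤ) + 1) / 2, by omega, by omega⟩
  obtain ⟨M, hM, hM'⟩ : ∃ M : ℤ, 2 * M ≤ N ∧ N ≤ 2 * M + 1 := ⟨N / 2, by omega, by omega⟩
  have hNθ : π / 2 ≤ N * θ := by
    have : (k : ℝ) ≤ 2 * N := by exact_mod_cast hN
    linarith [mul_le_mul_of_nonneg_right this hθ0.le]
  have hNθ' : 2 * (N * θ) ≤ π + θ := by
    have : 2 * (N : ℝ) ≤ k + 1 := by exact_mod_cast hN'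
    linarith [mul_le_mul_of_nonneg_right this hθ0.le]
  have hMθ : 2 * (M * θ) ≤ N * θ := by
    have : 2 * (M : ℝ) ≤ N := by exact_mod_cast hM
    linarith [mul_le_mul_of_nonneg_right this hθ0.le]
  have hMθ' : N * θ ≤ 2 * (M * θ) + θ := by
    have : (N : ℝ) ≤ 2 * M + 1 := by exact_mod_cast hM'
    linarith [mul_le_mul_of_nonneg_right this hθ0.le]
  have hψf := (le_div_iff₀ hθ0).1 (Int.floor_le (ψ / θ))
  have hψf' := (div_lt_iff₀ hθ0).1 (Int.lt_floor_add_one (ψ / θ))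
  obtain ⟨lo, hlo⟩ : ∃ lo : ℤ, lo = ⌊ψ / θ⌋ - M := ⟨_, rfl⟩
  have hloθ : (lo : ℝ) * θ = ⌊ψ / θ⌋ * θ - M * θ := by
    rw [hlo]
    push_cast
    ring
  set S : Set P := {p | (p : Plane) ∈ cone u (lo * θ) (lo * θ + N * θ)} with hS
  have hvS : v ∈ S := by
    refine ⟨_, huv0, ψ, ⟨?_, ?_⟩, hψ0, hψ1⟩
    · linarith [Real.pi_gt_three]
    · linarith [Real.pi_gt_three]
  obtain ⟨y, hyS, hy⟩ := Set.exists_min_image S (fun p : P => dist (u : Plane) p)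
    (Set.toFinite S) ⟨v, hvS⟩
  obtain ⟨hy0, φ₀, ⟨hφ₀, hφ₀'⟩, hy1, hy2⟩ := polar_of_mem_cone hyS
  obtain ⟨J, hJ⟩ : ∃ J : ℤ, J = ⌊φ₀ / θ⌋ := ⟨_, rfl⟩
  have hJf := (le_div_iff₀ hθ0).1 (Int.floor_le (φ₀ / θ))
  have hJf' := (div_lt_iff₀ hθ0).1 (Int.lt_floor_add_one (φ₀ / θ))
  have hJlo : lo ≤ J := by
    rw [hJ, Int.le_floor, le_div_iff₀ hθ0]
    exact hφ₀
  have hJhi : J < lo + N := by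
    rw [hJ, Int.floor_lt, div_lt_iff₀ hθ0]
    push_cast
    linarith
  rw [← hJ] at hJf hJf'
  have hyJ : (y : Plane) ∈ sector k u J := by
    rw [sector, hθdef]
    exact ⟨_, hy0, φ₀, ⟨hJf, hJf'⟩, hy1, hy2⟩
  obtain ⟨x, w, hx, hxy, hw, hwx, hadj⟩ := hG.exists_edge hk J hyJ
  have hmin : ∀ p ∈ S, dist (u : Plane) x ≤ dist (u : Plane) p := fun p hp =>
    hxy.trans (hy p hp)
  have hxv : dist (u : Plane) x ≤ dist (u : Plane) v := hmin v hvS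
  obtain ⟨hx0, φ, ⟨hφ, hφ'⟩, hx1, hx2⟩ := polar_of_mem_cone hx
  rw [hθdef] at hφ hφ'
  have hJloθ : (lo : ℝ) * θ ≤ J * θ :=
    mul_le_mul_of_nonneg_right (by exact_mod_cast hJlo) hθ0.le
  have hJhiθ : ((J : ℝ) + 1) * θ ≤ lo * θ + N * θ := by
    have : (J : ℝ) + 1 ≤ lo + N := by exact_mod_cast hJhi
    linarith [mul_le_mul_of_nonneg_right this hθ0.le]
  have hgo : Reach G u x (B * dist (u : Plane) x) := by
    -- The horizontal axis is the boundary ray on the side of cone J, which keeps the descent index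
    -- times θ at most π/4. For the lower ray the frame is turned by a further half turn, `lo - k`,
    -- and viewed leftwards.
    rcases le_or_gt (2 * (lo + N - J)) (N + 1) with hJ2 | hJ2
    · have hidx : descentIndex k true (lo + N) (lo + N - 1 - J) = J := by
        simp only [descentIndex, if_true]
        ring
      rw [← hidx] at hx hw
      refine reach_of_nearest hG hk hθ ht hB.le hBt htB ih true (lo + N) (lo + N - 1 - J)
        (by omega) ?_ hx hw hwx hadj hxv ?_
      · rw [hθdef]
        have : 2 * ((lo : ℝ) + N - J) ≤ N + 1 := by exact_mod_cast hJ2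
        have := mul_le_mul_of_nonneg_right this hθ0.le
        push_cast
        linarith
      · intro p hp1 hp2
        obtain ⟨χ, h0, h1, h2, hd, hc, hs⟩ := exists_descent hp1 hp2
        obtain ⟨e0, e1⟩ := polar_of_rot hc hs
        refine hmin p ⟨_, hd, _, ⟨?_, ?_⟩, e0, e1⟩
        · simp only [descent, if_true, hθdef]
          push_cast
          linarith
        · simp only [descent, if_true, hθdef]
          push_cast
          linarith [h2 rfl]
    · have hidx : descentIndex k false (lo - k) (J - lo) = J := by
        simp only [descentIndex, Bool.false_eq_true, if_false]
        ring
      rw [← hidx] at hx hw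
      refine reach_of_nearest hG hk hθ ht hB.le hBt htB ih false (lo - k) (J - lo)
        (by omega) ?_ hx hw hwx hadj hxv ?_
      · rw [hθdef]
        have : (N : ℝ) + 1 < 2 * (lo + N - J) := by exact_mod_cast hJ2
        have := mul_lt_mul_of_pos_right this hθ0
        push_cast
        linarith
      · intro p hp1 hp2
        obtain ⟨χ, h0, h1, -, hd, hc, hs⟩ := exists_descent hp1 hp2
        obtain ⟨e0, e1⟩ := polar_of_rot hc hs
        refine hmin p ⟨_, hd, _, ⟨?_, ?_⟩, e0, e1⟩
        · simp only [descent, Bool.false_eq_true, if_false, hθdef]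
          push_cast
          linarith
        · simp only [descent, Bool.false_eq_true, if_false, hθdef]
          push_cast
          linarith
  -- Both sides of the sector are within (M + 1)θ ≤ π/4 + 5θ/4 of the direction of v.
  have hdist := dist_le_sub_of_angle (α := 2 * (π / 8 + 5 / 8 * (π / k)))
    (by linarith [Real.pi_gt_three]) hx1 hx2 hψ0 hψ1 hxv (by
      rw [hθdef, abs_le]
      constructor <;> linarith)
  rw [mul_div_cancel_left₀ _ two_ne_zero] at hdist
  obtain ⟨g, hg⟩ : ∃ g, 1 - 2 * Real.sin (π / 8 + 5 / 8 * (π / k)) = g := ⟨_, rfl⟩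
  rw [hg] at hdist hgain
  have hg0 : 0 < g := by
    by_contra hle
    push Not at hle
    linarith [mul_nonneg ht.le (neg_nonneg.2 hle)]
  have hlt : dist (x : Plane) v < dist (u : Plane) v := by
    linarith [mul_pos hx0 hg0]
  refine (hgo.trans (ih x v hlt)).mono ?_
  have h1 := mul_le_mul_of_nonneg_left hdist ht.le
  have h2 := mul_le_mul_of_nonneg_right hgain hx0.le
  linarith

/-! ### Constants -/

lemma sin_pi_div_eight_bounds :
    0.38265 ≤ Real.sin (π / 8) ∧ Real.sin (π / 8) ≤ 0.3827 := by
  have h1 : (1.41421 : ℝ) ≤ √2 := Real.le_sqrt_of_sq_le (by norm_num)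
  have h2 : √2 ≤ 1.41422 := Real.sqrt_le_iff.2 (by norm_num)
  rw [Real.sin_pi_div_eight]
  constructor
  · have : (0.7653 : ℝ) ≤ √(2 - √2) := Real.le_sqrt_of_sq_le (by linarith)
    linarith
  · have : √(2 - √2) ≤ 0.7654 := Real.sqrt_le_iff.2 ⟨by norm_num, by linarith⟩
    linarith

lemma sin_pi_div_eight_add_le {x : ℝ} (hx : 0 ≤ x) :
    Real.sin (π / 8 + x) ≤ Real.sin (π / 8) + 0.924 * x := by
  have hs := sin_pi_div_eight_bounds.1
  have hc : Real.cos (π / 8) ≤ 0.924 := by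
    have := Real.sin_sq_add_cos_sq (π / 8)
    by_contra hlt
    push Not at hlt
    nlinarith
  have hc0 : 0 ≤ Real.cos (π / 8) :=
    Real.cos_nonneg_of_neg_pi_div_two_le_of_le (by linarith [Real.pi_pos])
      (by linarith [Real.pi_pos])
  rw [Real.sin_add]
  have h1 : Real.sin (π / 8) * Real.cos x ≤ Real.sin (π / 8) * 1 :=
    mul_le_mul_of_nonneg_left (Real.cos_le_one x) (by linarith)
  have h2 : Real.cos (π / 8) * Real.sin x ≤ Real.cos (π / 8) * x :=
    mul_le_mul_of_nonneg_left (Real.sin_le hx) hc0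
  have h3 : Real.cos (π / 8) * x ≤ 0.924 * x := mul_le_mul_of_nonneg_right hc hx
  linarith

lemma le_tau {k : ℕ} (hk : 42 ≤ k) : 1 / 0.2347 ≤ tau (2 * k) := by
  have hk' : (42 : ℝ) ≤ k := by exact_mod_cast hk
  have hx : π / ((2 * k : ℕ) : ℝ) ≤ π / 84 := by
    refine div_le_div_of_nonneg_left Real.pi_pos.le (by norm_num) ?_
    push_cast
    linarith
  have hx0 : 0 ≤ π / ((2 * k : ℕ) : ℝ) := by positivity
  have hπ := Real.pi_lt_d2
  have hlo : Real.sin (π / 8) ≤ Real.sin (π / ((2 * k : ℕ) : ℝ) + π / 8) :=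
    Real.sin_le_sin_of_le_of_le_pi_div_two (by linarith [Real.pi_pos])
      (by linarith [Real.pi_pos]) (by linarith)
  have hhi := sin_pi_div_eight_add_le hx0
  rw [add_comm] at hhi
  have hs := sin_pi_div_eight_bounds
  rw [tau, ← one_div]
  exact one_div_le_one_div_of_le (by linarith) (by linarith)

lemma isGeometricSpanner_of_le {k : ℕ} (hk : 42 ≤ k) {P : Finset Plane} {G : SimpleGraph P}
    (hG : IsYaoYaoGraph (2 * k) P G) {t : ℝ} (ht : (√2 + 10000 / k) / 0.2347 ≤ t) :
    IsGeometricSpanner G t := by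
  have hk' : (42 : ℝ) ≤ k := by exact_mod_cast hk
  have hk0 : (0 : ℝ) < k := by linarith
  have hπ := Real.pi_lt_d4
  have hθ : π / k ≤ 3.1416 / k := div_le_div_of_nonneg_right hπ.le hk0.le
  have hθ42 : (3.1416 : ℝ) / k ≤ 3.1416 / 42 :=
    div_le_div_of_nonneg_left (by norm_num) (by norm_num) hk'
  have hθ0 : 0 < π / k := by positivity
  have h2 : (1.4142 : ℝ) ≤ √2 := Real.le_sqrt_of_sq_le (by norm_num)
  have h2' : √2 ≤ 1.4143 := Real.sqrt_le_iff.2 (by norm_num)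
  have hpos : (0 : ℝ) < 10000 / k := by positivity
  have ht0 : 0 < t := lt_of_lt_of_le (by positivity) ht
  have hs := sin_pi_div_eight_bounds
  -- The factor is only about 0.007 at k = 42, which the summand 10000/k outweighs.
  have hmain : 1 ≤ t * (0.2346 - 9.56 / k) := by
    have h3 : (1.4142 + 10000 / k) / 0.2347 ≤ t := by
      refine le_trans ?_ ht
      gcongr
    have h4 : (0 : ℝ) ≤ 0.2346 - 9.56 / k := by
      rw [sub_nonneg, div_le_iff₀ hk0]
      linarith
    refine le_trans ?_ (mul_le_mul_of_nonneg_right h3 h4)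
    rw [show (1.4142 + 10000 / (k : ℝ)) / 0.2347 * (0.2346 - 9.56 / k) =
      (1.4142 * k + 10000) * (0.2346 * k - 9.56) / (0.2347 * k ^ 2) by field_simp]
    rw [le_div_iff₀ (by positivity)]
    nlinarith
  obtain ⟨θ, hθdef⟩ : ∃ θ, π / k = θ := ⟨_, rfl⟩
  have h5 : 3.0396 * θ ≤ 9.56 / k := by
    rw [← hθdef]
    have : (9.56 : ℝ) / k = 9.56 / 3.1416 * (3.1416 / k) := by ring
    rw [this]
    linarith
  have hgain := sin_pi_div_eight_add_le (show 0 ≤ 5 / 8 * (π / k) by positivity)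
  -- B/t is the lower bound for 1 - 2 sin(π/8 + 5θ/8), with 1.155 = 2 · 0.924 · 5/8. In `htB` the
  -- θ-coefficients add up to 1.155 + 0.2346 + 1.65 = 3.0396.
  refine isGeometricSpanner_of_bounds (by omega) (by linarith) hG
    (B := t * (0.2346 - 1.155 * (π / k))) ht0 (mul_pos ht0 (by linarith)) ?_ ?_ ?_
  · have := mul_le_mul_of_nonneg_left
      (show √2 + (0.2346 - 1.155 * (π / k)) ≤ 33 / 20 by linarith) ht0.le
    linarith
  · have h6 := mul_le_mul_of_nonneg_left h5 ht0.le
    rw [hθdef]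
    nlinarith [mul_nonneg ht0.le (sq_nonneg θ)]
  · exact mul_le_mul_of_nonneg_left (by linarith) ht0.le

/-- The constant is a function of π/(2k) that is differentiable at 0. -/
lemma tau_sub_isBigO :
    (fun k : ℕ => tau (2 * k) - (1 - 2 * Real.sin (π / 8))⁻¹) =O[atTop]
      fun k : ℕ => (k : ℝ)⁻¹ := by
  have hs := sin_pi_div_eight_bounds
  have hdiff : DifferentiableAt ℝ (fun x : ℝ => (1 - 2 * Real.sin (x + π / 8))⁻¹) 0 := by
    refine DifferentiableAt.inv (by fun_prop) ?_
    rw [zero_add]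
    linarith
  have hO := hdiff.isBigO_sub
  have hlim : Tendsto (fun k : ℕ => π / 2 * (k : ℝ)⁻¹) atTop (nhds 0) := by
    simpa using (tendsto_inv_atTop_nhds_zero_nat (𝕜 := ℝ)).const_mul (π / 2)
  have h1 := hO.comp_tendsto hlim
  have h2 : (fun k : ℕ => π / 2 * (k : ℝ)⁻¹) =O[atTop] fun k : ℕ => (k : ℝ)⁻¹ :=
    (isBigO_refl _ _).const_mul_left _
  refine IsBigO.trans (h1.congr (fun k => ?_) (fun k => ?_)) h2
  · simp only [Function.comp, tau, zero_add]
    congr 5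
    push_cast
    rw [div_eq_mul_inv π (2 * _), mul_inv]
    ring
  · simp

end YaoYao

end

/-! ### Choice of τ' and asymptotics -/

theorem theorem1 :
    ∃ τ' t : ℕ → ℝ,
      (∀ k : ℕ, t k = τ' k * YaoYao.tau (2 * k)) ∧
      (∀ k : ℕ, 42 ≤ k → ∀ (P : Finset YaoYao.Plane) (G : SimpleGraph P),
        YaoYao.IsYaoYaoGraph (2 * k) P G → YaoYao.IsGeometricSpanner G (t k)) ∧
      (fun k : ℕ => τ' k - √2) =O[atTop] (fun k : ℕ => (k : ℝ)⁻¹) ∧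
      (fun k : ℕ => t k - √2 * (1 - 2 * Real.sin (π / 8))⁻¹) =O[atTop] (fun k : ℕ => (k : ℝ)⁻¹) ∧
      |√2 * (1 - 2 * Real.sin (π / 8))⁻¹ - 6.03| < 0.005 := by
  have hs := YaoYao.sin_pi_div_eight_bounds
  have hτ : (fun k : ℕ => 10000 / (k : ℝ)) =O[atTop] fun k : ℕ => (k : ℝ)⁻¹ := by
    simp only [div_eq_mul_inv]
    exact (isBigO_refl _ _).const_mul_left _
  -- Any τ' = √2 + C/k with C large enough for k = 42 would serve; 10000 is generous.
  refine ⟨fun k => √2 + 10000 / k, fun k => (√2 + 10000 / k) * YaoYao.tau (2 * k),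
    fun _ => rfl, ?_, ?_, ?_, ?_⟩
  · intro k hk P G hG
    refine YaoYao.isGeometricSpanner_of_le hk hG ?_
    rw [div_eq_mul_one_div]
    exact mul_le_mul_of_nonneg_left (YaoYao.le_tau hk) (by positivity)
  · simpa using hτ
  · have h1 := YaoYao.tau_sub_isBigO
    have hlim : Tendsto (fun k : ℕ => (k : ℝ)⁻¹) atTop (nhds 0) :=
      tendsto_inv_atTop_nhds_zero_nat
    have hbdd : (fun k : ℕ => YaoYao.tau (2 * k)) =O[atTop] fun _ : ℕ => (1 : ℝ) := by
      have h2 := (h1.trans (hlim.isBigO_one ℝ)).add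
        (isBigO_const_const (1 - 2 * Real.sin (π / 8))⁻¹ (one_ne_zero (α := ℝ)) atTop)
      refine h2.congr_left fun k => ?_
      simp
    have h3 := hτ.mul hbdd
    simp only [mul_one] at h3
    refine (h3.add (h1.const_mul_left √2)).congr_left fun k => ?_
    ring
  · have h1 : (1.41421 : ℝ) ≤ √2 := Real.le_sqrt_of_sq_le (by norm_num)
    have h2 : √2 ≤ 1.41422 := Real.sqrt_le_iff.2 (by norm_num)
    rw [← div_eq_mul_inv, abs_lt, sub_lt_iff_lt_add, lt_sub_iff_add_lt,
      lt_div_iff₀ (by linarith), div_lt_iff₀ (by linarith)]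
    constructor <;> linarith
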